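/- Let $K$ be a field, let $\sigma$ be an automorphism of $K$ of finite order $n$ with $n$ prime, let $F=\mathrm{Fix}(\sigma)$, and let $R=K[t;\sigma]$ be the skew polynomial ring with multiplication determined by $ta=\sigma(a)t$ for $a\in K$. Let $f\in R$ be monic of degree $m\ge 1$ such that the greatest common right divisor of $f$ and $t$ is $1$. Let $h(t)=\hat h(t^n)$, with $\hat h\in F[x]$ monic, be the minimal central left multiple of $f$, i.e. the nonzero polynomial of minimal degree in the center $F[t^n]$ of $R$, so normalised, that lies in $Rf$, and suppose that $\hat h$ is square-free (for example, irreducible) in $F[x]$. The eigenring of $f$ is the $F$-algebra $\mathcal E(f)=\{g\in R: fg\in Rf\}/Rf$, and $f$ is called a generalised A-polynomial if $\mathcal E(f)$ is a (finite-dimensional) central simple algebra over $F$. For $v\in K^\times$ and $\alpha \in K$ put $\Omega_v(\alpha)=\sigma(v)\alpha v^{-1}$. Then $f$ is a generalised A-polynomial if and only if one of the following holds: (i) there exists $a\in F^\times$ such that $a\ne N_{K/F}(b)$ for every $b\in K$, and $f(t)=t^n-a$; (ii) $m\le n$ and there exist $c_1,\dots,c_m,b\in K^\times$ with $c_m=1$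 such that $$f(t)=\prod_{i=1}^m\bigl(t-\Omega_{c_i}(b)\bigr)=(t-\Omega_{c_1}(b))\cdots(t-\Omega_{c_m}(b)).$$ Moreover, in case (i) $f$ is irreducible in $R$. -/

import Mathlib

/-!
# Skew polynomial rings `K[t;σ]`, eigenrings and generalised A-polynomials
-/

noncomputable section

/-! ## The skew polynomial ring `K[t;σ]` -/

/-- A copy of the field `K` that remembers the automorphism `σ`; it carries the action
`(k, a) ↦ σ ^ k a` of the additive monoid `ℕ`, through which Mathlib's skew polynomial ring
is twisted. -/
def TwistedField {K : Type*} [Field K] (_σ : K ≃+* K) : Type _ := K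

instance TwistedField.instField {K : Type*} [Field K] (σ : K ≃+* K) : Field (TwistedField σ) :=
  inferInstanceAs (Field K)

instance TwistedField.instMulSemiringAction {K : Type*} [Field K] (σ : K ≃+* K) :
    MulSemiringAction (Multiplicative ℕ) (TwistedField σ) where
  smul k a := (σ ^ Multiplicative.toAdd k : K ≃+* K) a
  one_smul _ := rfl
  mul_smul k l a := by
    change (σ ^ (Multiplicative.toAdd k + Multiplicative.toAdd l) : K ≃+* K) a = _
    rw [pow_add]
    rfl
  smul_zero k := map_zero (σ ^ Multiplicative.toAdd k : K ≃+* K)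
  smul_add k := map_add (σ ^ Multiplicative.toAdd k : K ≃+* K)
  smul_one k := map_one (σ ^ Multiplicative.toAdd k : K ≃+* K)
  smul_mul k := map_mul (σ ^ Multiplicative.toAdd k : K ≃+* K)

/-- The identity map from `K` to its copy `TwistedField σ`. -/
def TwistedField.of {K : Type*} [Field K] (σ : K ≃+* K) : K ≃+* TwistedField σ :=
  RingEquiv.refl K

/-- The endomorphism that twists the multiplication is `σ`. -/
theorem TwistedField.phi_of {K : Type*} [Field K] (σ : K ≃+* K) (a : K) :
    (SkewPolynomial.φ : TwistedField σ →+* TwistedField σ) (of σ a) = of σ (σ a) := rfl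

/-- The skew polynomial ring `K[t;σ]`: polynomials `∑ aᵢ tⁱ` with coefficients on the left, usual
addition, and multiplication determined by `t a = σ(a) t`. -/
abbrev SkewPoly {K : Type*} [Field K] (σ : K ≃+* K) : Type _ := SkewPolynomial (TwistedField σ)

namespace SkewPoly

/-- The indeterminate `t` of `K[t;σ]`. -/
abbrev t {K : Type*} [Field K] (σ : K ≃+* K) : SkewPoly σ := SkewPolynomial.X

/-- The embedding of `K` into `K[t;σ]` as constant polynomials. -/
def const {K : Type*} [Field K] (σ : K ≃+* K) : K →+* SkewPoly σ :=
  (SkewPolynomial.CRingHom : TwistedField σ →+* SkewPolynomial (TwistedField σ)).comp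
    (TwistedField.of σ : K →+* TwistedField σ)

/-- Constants as monomials of degree `0`. -/
theorem const_eq_monomial {K : Type*} [Field K] (σ : K ≃+* K) (a : K) :
    const σ a = SkewPolynomial.monomial 0 (TwistedField.of σ a) := rfl

/-- The defining commutation rule `t a = σ(a) t`. -/
theorem t_mul_const {K : Type*} [Field K] (σ : K ≃+* K) (a : K) :
    t σ * const σ a = const σ (σ a) * t σ := by
  rw [const_eq_monomial, const_eq_monomial, SkewPolynomial.X_mul_monomial,
    SkewPolynomial.monomial_mul_X, TwistedField.phi_of]

/-- The degree of a skew polynomial (with value `0` at the zero polynomial). -/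
def natDegree {K : Type*} [Field K] {σ : K ≃+* K} (f : SkewPoly σ) : ℕ :=
  (SkewPolynomial.support f).sup id

/-- A skew polynomial is monic if its leading coefficient is `1`. -/
def IsMonic {K : Type*} [Field K] {σ : K ≃+* K} (f : SkewPoly σ) : Prop :=
  SkewPolynomial.coeff f (natDegree f) = 1

/-- The fixed field `F = Fix(σ)`. -/
def fixedField {K : Type*} [Field K] (σ : K ≃+* K) : Subfield K :=
  RingHom.eqLocusField (σ : K →+* K) (RingHom.id K)

/-- Constants in the fixed field of `σ` are central in `K[t;σ]`. -/
theorem const_fixed_commutes {K : Type*} [Field K] (σ : K ≃+* K) (a : fixedField σ)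
    (p : SkewPoly σ) : const σ (a : K) * p = p * const σ (a : K) := by
  have ha : ∀ k : ℕ, (SkewPolynomial.φ : TwistedField σ →+* TwistedField σ)^[k]
      (TwistedField.of σ (a : K)) = TwistedField.of σ (a : K) := by
    intro k
    refine Function.iterate_fixed ?_ k
    rw [TwistedField.phi_of]
    exact congrArg (TwistedField.of σ) a.2
  rw [const_eq_monomial]
  induction p using SkewPolynomial.induction with
  | h0 => simp only [mul_zero, zero_mul]
  | ha n r q _ _ hq =>
    rw [mul_add, add_mul, hq, SkewPolynomial.monomial_mul_monomial,
      SkewPolynomial.monomial_mul_monomial, ha n, zero_add, add_zero, Function.iterate_zero, id_eq,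
      mul_comm]

/-- `K[t;σ]` is an algebra over `F = Fix(σ)`, through the constant polynomials. -/
instance instAlgebraFixedField {K : Type*} [Field K] (σ : K ≃+* K) :
    Algebra (fixedField σ) (SkewPoly σ) :=
  RingHom.toAlgebra' ((const σ).comp (fixedField σ).subtype) (const_fixed_commutes σ)

/-- `(f, g)_r = 1`: every common right divisor of `f` and `g` is a unit. -/
def IsRightCoprime {K : Type*} [Field K] {σ : K ≃+* K} (f g : SkewPoly σ) : Prop :=
  ∀ d : SkewPoly σ, f ∈ Ideal.span {d} → g ∈ Ideal.span {d} → IsUnit d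

/-- `ĥ ∈ F[x]` is the monic polynomial for which `h = ĥ(tⁿ)` is the minimal central left multiple
of `f`: a polynomial of minimal degree among the nonzero central elements of `K[t;σ]`
that lie in `K[t;σ] f`. Here `n` is the order of `σ`. -/
structure IsMinimalCentralLeftMultiple {K : Type*} [Field K] {σ : K ≃+* K} (n : ℕ)
    (f : SkewPoly σ) (hhat : Polynomial (fixedField σ)) : Prop where
  monic : hhat.Monic
  mem_center : Polynomial.aeval (t σ ^ n) hhat ∈ Subring.center (SkewPoly σ)
  left_multiple : Polynomial.aeval (t σ ^ n) hhat ∈ Ideal.span {f}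
  minimal : ∀ z ∈ Subring.center (SkewPoly σ), z ≠ 0 → z ∈ Ideal.span {f} →
    natDegree (Polynomial.aeval (t σ ^ n) hhat) ≤ natDegree z

/-- The map `Ω_v(α) = σ(v) α v⁻¹` on `K`. -/
def Omega {K : Type*} [Field K] (σ : K ≃+* K) (v : Kˣ) (α : K) : K :=
  σ (v : K) * α * (v : K)⁻¹

end SkewPoly

/-! ## Idealisers and eigenrings -/

/-- The idealiser `I(f) = {g ∈ R : f g ∈ R f}`, a subalgebra of `R`. For a noncommutative ring,
`Ideal.span {f}` is the left ideal `R f`. -/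
def idealiser (F : Type*) {R : Type*} [CommRing F] [Ring R] [Algebra F R] (f : R) :
    Subalgebra F R where
  carrier := {g | f * g ∈ Ideal.span {f}}
  mul_mem' := by
    intro a b ha hb
    obtain ⟨q, hq⟩ := Ideal.mem_span_singleton'.mp ha
    change f * (a * b) ∈ Ideal.span {f}
    rw [← mul_assoc, ← hq, mul_assoc]
    exact Ideal.mul_mem_left _ q hb
  add_mem' := by
    intro a b ha hb
    change f * (a + b) ∈ Ideal.span {f}
    rw [mul_add]
    exact Ideal.add_mem _ ha hb
  algebraMap_mem' := by
    intro r
    change f * algebraMap F R r ∈ Ideal.span {f}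
    rw [← Algebra.commutes]
    exact Ideal.mul_mem_left _ _ (Ideal.mem_span_singleton_self f)

/-- The left ideal `R f`, as an ideal of the idealiser `I(f)`. -/
def idealiserIdeal (F : Type*) {R : Type*} [CommRing F] [Ring R] [Algebra F R] (f : R) :
    Ideal (idealiser F f) :=
  Ideal.comap (idealiser F f).val (Ideal.span {f})

instance idealiserIdeal.instIsTwoSided (F : Type*) {R : Type*} [CommRing F] [Ring R] [Algebra F R]
    (f : R) : (idealiserIdeal F f).IsTwoSided where
  mul_mem_of_left := by
    intro a b ha
    obtain ⟨q, hq⟩ := Ideal.mem_span_singleton'.mp (show (a : R) ∈ Ideal.span {f} from ha)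
    change (a : R) * (b : R) ∈ Ideal.span {f}
    rw [← hq, mul_assoc]
    exact Ideal.mul_mem_left _ q b.2

/-- The eigenring `E(f) = I(f) / R f`, an `F`-algebra. -/
abbrev Eigenring (F : Type*) {R : Type*} [CommRing F] [Ring R] [Algebra F R] (f : R) : Type _ :=
  idealiser F f ⧸ idealiserIdeal F f

/-- `f ∈ K[t;σ]` is a generalised A-polynomial if its eigenring is a central simple algebra over
`F = Fix(σ)`: finite-dimensional, with centre `F`, and simple. -/
structure IsGeneralisedAPolynomial {K : Type*} [Field K] {σ : K ≃+* K} (f : SkewPoly σ) :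
    Prop where
  finite : Module.Finite (SkewPoly.fixedField σ) (Eigenring (SkewPoly.fixedField σ) f)
  central : Algebra.IsCentral (SkewPoly.fixedField σ) (Eigenring (SkewPoly.fixedField σ) f)
  simple : IsSimpleRing (Eigenring (SkewPoly.fixedField σ) f)

end

/-!
Let `n` be the order of `σ`. The polynomials `tⁿ - a` with `a ∈ F` are central, and for `a ≠ 0`
the quotient `R / R(tⁿ - a)` is the cyclic algebra `(K/F, σ, a)`, which is central simple over
`F`. The eigenring of `f` is the opposite of `End_R(R / Rf)`. If `tⁿ - a ∈ Rf`, then `R / Rf` is a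
module over that cyclic algebra, so its endomorphism ring is a matrix algebra over a central
division algebra; conversely, if the eigenring has centre `F`, then the central element `tⁿ` acts
as a scalar `a`, that is `tⁿ - a ∈ Rf`, and `a ≠ 0` because `f` has a nonzero constant term. So
everything depends on the left divisors of `tⁿ - a`.

If `a = N(b)`, then `tⁿ - a` is a multiple of `t - b`. As the cyclic algebra is simple, the
cofactor does not annihilate `R / Rf`, which yields a nonzero `p` of degree less than `deg f` with
`(t - b) p ∈ Rf`; comparing degrees, `(t - b) p` is a scalar multiple of `f`. Normalising `p`
turns `b` into some `Ω_c(b)`, and induction factors `f` into such linear terms. If `a` is not a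
norm, the dimension of a simple module `R / Rg` divides that of the cyclic algebra, so `deg g`
divides the prime `n`; as `deg g = 1` would make `a` a norm, every divisor of `tⁿ - a` of
positive degree has degree `n`.

Finally, a product of `m` factors `t - Ω_c(b)` divides `(tⁿ - N(b))^m` because each factor divides
the central element `tⁿ - N(b)`, so `ĥ` divides `(x - N(b))^m`, and being square-free it divides
`x - N(b)`.
-/

noncomputable section

universe u

section SurjectiveImage

variable {R : Type*} [Ring R] {f : R}

theorem map_mem_span_singleton_iff {A Φ : Type*} [Ring A] [FunLike Φ R A] [RingHomClass Φ R A]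
    {φ : Φ} (hφ : Function.Surjective φ) (hker : RingHom.ker φ ≤ Ideal.span {f}) {x : R} :
    φ x ∈ Ideal.span {φ f} ↔ x ∈ Ideal.span {f} := by
  rw [← Set.image_singleton, ← Ideal.map_span, ← Ideal.mem_comap,
    Ideal.comap_map_of_surjective' φ hφ, sup_eq_left.2 hker]

theorem span_singleton_map_eq_top_iff {A Φ : Type*} [Ring A] [FunLike Φ R A] [RingHomClass Φ R A]
    {φ : Φ} (hφ : Function.Surjective φ) (hker : RingHom.ker φ ≤ Ideal.span {f}) :
    Ideal.span {φ f} = ⊤ ↔ Ideal.span {f} = ⊤ := by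
  rw [Ideal.eq_top_iff_one, Ideal.eq_top_iff_one, ← map_one φ, map_mem_span_singleton_iff hφ hker]

theorem nonempty_quotient_span_linearEquiv_map {F A : Type*} [CommRing F] [Ring A]
    [Algebra F R] [Algebra F A] (φ : R →ₐ[F] A)
    (hφ : Function.Surjective φ) (hker : RingHom.ker φ ≤ Ideal.span {f}) :
    Nonempty ((R ⧸ Ideal.span {f}) ≃ₗ[F] A ⧸ Ideal.span {φ f}) := by
  let ψ : R →ₗ[F] A ⧸ Ideal.span {φ f} :=
    ((Ideal.span {φ f}).mkQ.restrictScalars F).comp φ.toLinearMap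
  have hψ : Function.Surjective ψ := (Submodule.mkQ_surjective _).comp hφ
  have hker : ψ.ker = (Ideal.span {f}).restrictScalars F := Submodule.ext fun x =>
    (Submodule.Quotient.mk_eq_zero _).trans (map_mem_span_singleton_iff hφ hker)
  exact ⟨(Submodule.Quotient.restrictScalarsEquiv F (Ideal.span {f})).symm.trans <|
    (Submodule.quotEquivOfEq _ _ hker.symm).trans (ψ.quotKerEquivOfSurjective hψ)⟩

end SurjectiveImage

namespace Eigenring

variable {F R : Type*} [CommRing F] [Ring R] [Algebra F R] {f : R}

theorem mem_idealiser {g : R} : g ∈ idealiser F f ↔ f * g ∈ Ideal.span {f} := Iff.rfl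

theorem mk_eq_zero_iff {x : idealiser F f} :
    Ideal.Quotient.mk (idealiserIdeal F f) x = 0 ↔ (x : R) ∈ Ideal.span {f} :=
  Ideal.Quotient.eq_zero_iff_mem

theorem nonempty_algEquiv_of_surjective {B : Type*} [Ring B] [Algebra F B]
    (φ : idealiser F f →ₐ[F] B) (hφ : Function.Surjective φ)
    (hker : ∀ x, φ x = 0 ↔ (x : R) ∈ Ideal.span {f}) : Nonempty (Eigenring F f ≃ₐ[F] B) := by
  have hI : idealiserIdeal F f = RingHom.ker φ := Ideal.ext fun x => (hker x).symm
  exact ⟨(Ideal.quotientEquivAlgOfEq F hI).trans (Ideal.quotientKerAlgEquivOfSurjective hφ)⟩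

theorem nonempty_algEquiv_map {A : Type*} [Ring A] [Algebra F A] (φ : R →ₐ[F] A)
    (hφ : Function.Surjective φ) (hker : RingHom.ker φ ≤ Ideal.span {f}) :
    Nonempty (Eigenring F f ≃ₐ[F] Eigenring F (φ f)) := by
  have hmem (x : R) : φ x ∈ Ideal.span {φ f} ↔ x ∈ Ideal.span {f} :=
    map_mem_span_singleton_iff hφ hker
  let ψ : idealiser F f →ₐ[F] idealiser F (φ f) :=
    (φ.comp (idealiser F f).val).codRestrict _ fun g =>
      mem_idealiser.2 (by simpa using (hmem _).2 g.2)
  refine nonempty_algEquiv_of_surjective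
    ((Ideal.Quotient.mkₐ F (idealiserIdeal F (φ f))).comp ψ) ?_ fun x =>
      mk_eq_zero_iff.trans (hmem x)
  refine (Ideal.Quotient.mkₐ_surjective F _).comp fun ⟨y, hy⟩ => ?_
  obtain ⟨x, rfl⟩ := hφ y
  exact ⟨⟨x, (hmem _).1 ((map_mul φ f x).symm ▸ hy)⟩, rfl⟩

variable (F f) in
/-- An element `g` of the idealiser of `f` acts on `R ⧸ R f` by right multiplication. -/
def rightMul : idealiser F f →ₐ[F] (Module.End R (R ⧸ Ideal.span {f}))ᵐᵒᵖ :=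
  AlgHom.ofLinearMap
    { toFun g := MulOpposite.op <| (Ideal.span {f}).mapQ (Ideal.span {f})
        (LinearMap.toSpanSingleton R R (g : R)) <|
          (Ideal.span_singleton_le_iff_mem _).2 (mem_idealiser.1 g.2)
      map_add' g h := by
        apply MulOpposite.unop_injective
        ext
        simp
      map_smul' a g := by
        apply MulOpposite.unop_injective
        ext
        simp }
    (by
      apply MulOpposite.unop_injective
      ext
      simp)
    (fun g h => by
      apply MulOpposite.unop_injective
      ext
      simp)

theorem rightMul_apply_mk (g : idealiser F f) (x : R) :
    (rightMul F f g).unop (Submodule.Quotient.mk x) = Submodule.Quotient.mk (x * g) := rfl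

theorem rightMul_eq_zero_iff {g : idealiser F f} :
    rightMul F f g = 0 ↔ (g : R) ∈ Ideal.span {f} := by
  rw [← Submodule.Quotient.mk_eq_zero, ← MulOpposite.unop_eq_zero_iff]
  refine ⟨fun h => ?_, fun h => ?_⟩
  · rw [← one_mul (g : R), ← rightMul_apply_mk, h, LinearMap.zero_apply]
  · ext
    rw [LinearMap.comp_apply, LinearMap.comp_apply, Submodule.mkQ_apply, rightMul_apply_mk, one_mul,
      h]
    rfl

theorem rightMul_surjective : Function.Surjective (rightMul F f) := by
  intro T
  obtain ⟨g, hg⟩ := Submodule.Quotient.mk_surjective _ (T.unop (Submodule.Quotient.mk 1))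
  have hT (x : R) : T.unop (Submodule.Quotient.mk x) = Submodule.Quotient.mk (x * g) := by
    rw [← smul_eq_mul x g, Submodule.Quotient.mk_smul, hg, ← map_smul,
      ← Submodule.Quotient.mk_smul, smul_eq_mul, mul_one]
  have hfg : f * g ∈ Ideal.span {f} := by
    rw [← Submodule.Quotient.mk_eq_zero, ← hT, (Submodule.Quotient.mk_eq_zero _).2
      (Ideal.mem_span_singleton_self f), map_zero]
  refine ⟨⟨g, mem_idealiser.2 hfg⟩, MulOpposite.unop_injective ?_⟩
  ext
  exact (hT _).symm

variable (F f) in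
theorem nonempty_algEquiv_end :
    Nonempty (Eigenring F f ≃ₐ[F] (Module.End R (R ⧸ Ideal.span {f}))ᵐᵒᵖ) :=
  nonempty_algEquiv_of_surjective (rightMul F f) rightMul_surjective fun _ => rightMul_eq_zero_iff

end Eigenring

section SimpleArtinian

variable {A : Type u} [Ring A]

theorem nonempty_linearEquiv_of_isSimpleModule [IsSimpleRing A] [IsArtinianRing A]
    (S T : Type*) [AddCommGroup S] [Module A S] [IsSimpleModule A S]
    [AddCommGroup T] [Module A T] [IsSimpleModule A T] : Nonempty (S ≃ₗ[A] T) := by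
  obtain ⟨I, ⟨eI⟩⟩ := IsSemisimpleRing.exists_linearEquiv_ideal_of_isSimpleModule A S
  obtain ⟨J, ⟨eJ⟩⟩ := IsSemisimpleRing.exists_linearEquiv_ideal_of_isSimpleModule A T
  have := IsSimpleModule.congr eI.symm
  have := IsSimpleModule.congr eJ.symm
  obtain ⟨e⟩ := IsSimpleRing.isIsotypic A A J I
  exact ⟨eI.trans (e.trans eJ.symm)⟩

theorem finrank_dvd_of_isSimpleModule {F : Type*} [Field F] [Algebra F A] [Module.Finite F A]
    [IsSimpleRing A] (S : Type*) [AddCommGroup S] [Module A S] [Module F S] [IsScalarTower F A S]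
    [IsSimpleModule A S] : Module.finrank F S ∣ Module.finrank F A := by
  have := IsArtinianRing.of_finite F A
  obtain ⟨k, _, T, _, ⟨e⟩⟩ := (IsSimpleRing.isIsotypic A A).linearEquiv_fun
  obtain ⟨e'⟩ := nonempty_linearEquiv_of_isSimpleModule (A := A) T S
  have : Module.Finite F S := .trans A S
  have h := ((e.trans (.piCongrRight fun _ => e')).restrictScalars F).finrank_eq
  rw [Module.finrank_pi_fintype, Finset.sum_const, smul_eq_mul] at h
  exact h ▸ dvd_mul_left _ _

theorem finrank_quotient_span_dvd {F R : Type*} [Field F] [Algebra F A] [Module.Finite F A]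
    [IsSimpleRing A] [Ring R] [Algebra F R] {f : R} (φ : R →ₐ[F] A) (hφ : Function.Surjective φ)
    (hker : RingHom.ker φ ≤ Ideal.span {f}) (hf : (Ideal.span {f}).IsMaximal) :
    Module.finrank F (R ⧸ Ideal.span {f}) ∣ Module.finrank F A := by
  obtain ⟨e⟩ := nonempty_quotient_span_linearEquiv_map φ hφ hker
  have hmax := (Ideal.map_eq_top_or_isMaximal_of_surjective φ hφ hf).resolve_left <| by
    rw [Ideal.map_span, Set.image_singleton, span_singleton_map_eq_top_iff hφ hker]
    exact hf.ne_top
  rw [Ideal.map_span, Set.image_singleton] at hmax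
  have : IsSimpleModule A (A ⧸ Ideal.span {φ f}) := isSimpleModule_iff_isCoatom.2 hmax.out
  rw [e.finrank_eq]
  exact finrank_dvd_of_isSimpleModule (A := A) _

theorem exists_mul_notMem_of_ne_top [IsSimpleRing A] {I : Ideal A} (hI : I ≠ ⊤) {p : A}
    (hp : p ≠ 0) : ∃ g, p * g ∉ I := by
  by_contra! h
  have := Submodule.Quotient.nontrivial_iff.2 hI
  have hann : p ∈ Module.annihilator A (A ⧸ I) := Module.mem_annihilator.2 fun x => by
    obtain ⟨g, rfl⟩ := Submodule.Quotient.mk_surjective _ x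
    exact (Submodule.Quotient.mk_eq_zero _).2 (h g)
  rcases (isSimpleRing_iff_isTwoSided_imp.1 ‹_›).2 (Module.annihilator A (A ⧸ I)) inferInstance
    with hbot | htop
  · exact hp (by rwa [hbot] at hann)
  · exact not_subsingleton _ (Module.annihilator_eq_top_iff.1 htop)

theorem exists_algEquiv_matrix_end {F : Type*} [CommRing F] [Algebra F A] [IsSimpleRing A]
    [IsArtinianRing A]
    (M S : Type*) [AddCommGroup M] [Module A M] [Module F M] [IsScalarTower F A M]
    [Module.Finite A M] [Nontrivial M]
    [AddCommGroup S] [Module A S] [Module F S] [IsScalarTower F A S] [IsSimpleModule A S] :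
    ∃ (k : ℕ) (_ : NeZero k), Nonempty
      (Module.End A M ≃ₐ[F] Matrix (Fin k) (Fin k) (Module.End A S)) := by
  obtain ⟨k, hk, T, _, ⟨e⟩⟩ := (IsSimpleRing.isIsotypic A M).linearEquiv_fun
  obtain ⟨e'⟩ := nonempty_linearEquiv_of_isSimpleModule (A := A) T S
  exact ⟨k, hk, ⟨(e.conjAlgEquiv F).trans <| (endVecAlgEquivMatrixEnd ..).trans
    (e'.conjAlgEquiv F).mapMatrix⟩⟩

variable (A) in
theorem isSimpleRing_moduleEnd [IsSimpleRing A] [IsArtinianRing A] (M : Type*) [AddCommGroup M]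
    [Module A M] [Module.Finite A M] [Nontrivial M] : IsSimpleRing (Module.End A M) := by
  classical
  obtain ⟨k, _, S, _, ⟨e⟩⟩ := (IsSimpleRing.isIsotypic A M).linearEquiv_fun
  exact .of_ringEquiv (e.conjRingEquiv.trans (endVecRingEquivMatrixEnd ..)).symm inferInstance

theorem isCentral_of_isCentral_matrix {F ι D : Type*} [Fintype ι] [DecidableEq ι] [Nonempty ι]
    [CommRing F] [Ring D] [Algebra F D] [h : Algebra.IsCentral F (Matrix ι ι D)] :
    Algebra.IsCentral F D where
  out x hx := by
    have i := Classical.arbitrary ι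
    have : Matrix.scalar ι x ∈ Subalgebra.center F (Matrix ι ι D) := by
      rw [Matrix.subalgebraCenter_eq_scalarAlgHom_map]
      exact ⟨x, hx, rfl⟩
    obtain ⟨a, ha⟩ := h.out this
    exact ⟨a, by simpa [Matrix.algebraMap_matrix_apply] using congr_fun₂ ha i i⟩

theorem isCentral_moduleEnd {F : Type*} [CommRing F] [Algebra F A] [IsSimpleRing A]
    [IsArtinianRing A] [Algebra.IsCentral F A]
    (M : Type u) [AddCommGroup M] [Module A M] [Module F M] [IsScalarTower F A M]
    [Module.Finite A M] [Nontrivial M] : Algebra.IsCentral F (Module.End A M) := by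
  obtain ⟨n, _, I, _, ⟨e⟩⟩ := IsSimpleRing.exists_algEquiv_matrix_end_mulOpposite F A
  obtain ⟨k, _, ⟨e'⟩⟩ := exists_algEquiv_matrix_end (F := F) (A := A) M I
  have := Algebra.IsCentral.of_algEquiv F _ _ e
  have : Algebra.IsCentral F (Module.End A I)ᵐᵒᵖ := isCentral_of_isCentral_matrix (ι := Fin n)
  have := Algebra.IsCentral.of_algEquiv F _ _ (AlgEquiv.opOp F (Module.End A I)).symm
  exact .of_algEquiv F _ _ e'.symm

end SimpleArtinian

namespace Eigenring

variable {F A : Type*} [CommRing F] [Ring A] [Algebra F A] [IsSimpleRing A]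

theorem isSimpleRing [IsArtinianRing A] {f : A} (hf : Ideal.span {f} ≠ ⊤) :
    IsSimpleRing (Eigenring F f) := by
  have := Submodule.Quotient.nontrivial_iff.2 hf
  have := isSimpleRing_moduleEnd A (A ⧸ Ideal.span {f})
  obtain ⟨e⟩ := nonempty_algEquiv_end F f
  exact .of_ringEquiv e.symm.toRingEquiv inferInstance

theorem isCentral [IsArtinianRing A] [Algebra.IsCentral F A] {f : A} (hf : Ideal.span {f} ≠ ⊤) :
    Algebra.IsCentral F (Eigenring F f) := by
  have := Submodule.Quotient.nontrivial_iff.2 hf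
  have := isCentral_moduleEnd (F := F) (A := A) (A ⧸ Ideal.span {f})
  obtain ⟨e⟩ := nonempty_algEquiv_end F f
  exact .of_algEquiv F _ _ e.symm

theorem finite_isCentral_isSimpleRing_of_surjective {F : Type*} {A R : Type u} [Field F] [Ring A]
    [Algebra F A] [Module.Finite F A] [Algebra.IsCentral F A] [IsSimpleRing A] [Ring R]
    [Algebra F R] {f : R} (hf : Ideal.span {f} ≠ ⊤) (φ : R →ₐ[F] A) (hφ : Function.Surjective φ)
    (hker : RingHom.ker φ ≤ Ideal.span {f}) :
    Module.Finite F (Eigenring F f) ∧ Algebra.IsCentral F (Eigenring F f) ∧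
      IsSimpleRing (Eigenring F f) := by
  have hφf : Ideal.span {φ f} ≠ ⊤ := by rwa [Ne, span_singleton_map_eq_top_iff hφ hker]
  have := IsArtinianRing.of_finite F A
  have := isCentral (F := F) hφf
  have := isSimpleRing (F := F) hφf
  obtain ⟨e⟩ := nonempty_algEquiv_map φ hφ hker
  exact ⟨.equiv e.symm.toLinearEquiv, .of_algEquiv F _ _ e.symm,
    .of_ringEquiv e.symm.toRingEquiv inferInstance⟩

end Eigenring

namespace SkewPoly

open Finset

variable {K : Type*} [Field K] {σ : K ≃+* K}

section Coefficients

/-- The coefficients of a skew polynomial as elements of `K`, with the powers of `t` on the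
right. -/
def coeff : SkewPoly σ →+ ℕ → K where
  toFun p i := (TwistedField.of σ).symm (SkewPolynomial.coeff p i)
  map_zero' := rfl
  map_add' p q := funext fun i => by simp

theorem coeff_injective : Function.Injective (coeff (σ := σ)) := fun _ _ h =>
  SkewPolynomial.ext fun i => congr_fun h i

theorem coeff_mul (p q : SkewPoly σ) (k : ℕ) :
    coeff (p * q) k = ∑ x ∈ antidiagonal k, coeff p x.1 * (σ ^ x.1 : K ≃+* K) (coeff q x.2) :=
  SkewMonoidAlgebra.coeff_mul_antidiagonal_of_finset p q (Multiplicative.ofAdd k)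
    (antidiagonal k : Finset (ℕ × ℕ)) mem_antidiagonal

theorem coeff_const_mul_t_pow (a : K) (k i : ℕ) :
    coeff (const σ a * t σ ^ k) i = if i = k then a else 0 := by
  rw [const_eq_monomial, SkewPolynomial.monomial_mul_X_pow, zero_add]
  exact SkewPolynomial.coeff_monomial.trans (if_congr eq_comm rfl rfl)

theorem coeff_t_pow (k i : ℕ) : coeff (t σ ^ k) i = if i = k then 1 else 0 := by
  simpa using coeff_const_mul_t_pow (σ := σ) 1 k i

theorem coeff_const (a : K) (i : ℕ) : coeff (const σ a) i = if i = 0 then a else 0 := by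
  simpa using coeff_const_mul_t_pow (σ := σ) a 0 i

theorem coeff_const_mul (a : K) (p : SkewPoly σ) (i : ℕ) :
    coeff (const σ a * p) i = a * coeff p i := by
  rw [coeff_mul, sum_eq_single (0, i)]
  · simp [coeff_const]
  · rintro ⟨j, l⟩ h hne
    have hj : j ≠ 0 := by grind [HasAntidiagonal.mem_antidiagonal]
    simp [coeff_const, hj]
  · simp

theorem coeff_mul_const (p : SkewPoly σ) (a : K) (i : ℕ) :
    coeff (p * const σ a) i = coeff p i * (σ ^ i : K ≃+* K) a := by
  rw [coeff_mul, sum_eq_single (i, 0)]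
  · simp [coeff_const]
  · rintro ⟨j, l⟩ h hne
    have hl : l ≠ 0 := by grind [HasAntidiagonal.mem_antidiagonal]
    simp [coeff_const, hl]
  · simp

theorem coeff_mul_of_forall_lt {p : SkewPoly σ} {i : ℕ} (h : ∀ j < i, coeff p j = 0)
    (q : SkewPoly σ) : coeff (p * q) i = coeff p i * (σ ^ i : K ≃+* K) (coeff q 0) := by
  rw [coeff_mul, sum_eq_single (i, 0)]
  · rintro ⟨j, l⟩ hjl hne
    have hj : j < i := by grind [HasAntidiagonal.mem_antidiagonal]
    rw [h j hj, zero_mul]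
  · simp

theorem coeff_mul_add {p q : SkewPoly σ} {a b : ℕ} (hp : ∀ i, a < i → coeff p i = 0)
    (hq : ∀ i, b < i → coeff q i = 0) :
    coeff (p * q) (a + b) = coeff p a * (σ ^ a : K ≃+* K) (coeff q b) := by
  rw [coeff_mul, sum_eq_single (a, b)]
  · rintro ⟨i, j⟩ h hne
    obtain hi | hj : a < i ∨ b < j := by grind [HasAntidiagonal.mem_antidiagonal]
    · rw [hp i hi, zero_mul]
    · rw [hq j hj, map_zero, mul_zero]
  · simp

theorem coeff_mul_of_lt {p q : SkewPoly σ} {a b k : ℕ} (hp : ∀ i, a < i → coeff p i = 0)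
    (hq : ∀ i, b < i → coeff q i = 0) (hk : a + b < k) : coeff (p * q) k = 0 := by
  rw [coeff_mul]
  refine sum_eq_zero fun ⟨i, j⟩ h => ?_
  obtain hi | hj : a < i ∨ b < j := by grind [HasAntidiagonal.mem_antidiagonal]
  · rw [hp i hi, zero_mul]
  · rw [hq j hj, map_zero, mul_zero]

theorem sum_const_coeff_mul_t_pow {p : SkewPoly σ} {d : ℕ} (h : ∀ i, d ≤ i → coeff p i = 0) :
    ∑ i ∈ range d, const σ (coeff p i) * t σ ^ i = p := by
  refine coeff_injective (funext fun j => ?_)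
  simp only [map_sum, Finset.sum_apply, coeff_const_mul_t_pow, sum_ite_eq, mem_range]
  split_ifs with hj
  · rfl
  · exact (h j (not_lt.1 hj)).symm

theorem t_pow_mul_const (k : ℕ) (a : K) :
    t σ ^ k * const σ a = const σ ((σ ^ k : K ≃+* K) a) * t σ ^ k := by
  refine coeff_injective (funext fun i => ?_)
  rw [coeff_mul_const, coeff_const_mul_t_pow, coeff_t_pow]
  split_ifs with h
  · rw [h, one_mul]
  · rw [zero_mul]

end Coefficients

section Degree

theorem natDegree_le_iff {p : SkewPoly σ} {d : ℕ} :
    natDegree p ≤ d ↔ ∀ i, d < i → coeff p i = 0 := by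
  have hsupp (i : ℕ) : i ∈ SkewPolynomial.support p ↔ coeff p i ≠ 0 :=
    SkewPolynomial.mem_support_iff
  rw [natDegree, Finset.sup_le_iff]
  simp only [hsupp, id_eq]
  exact forall_congr' fun i => by rw [← not_lt, not_imp_not]

theorem coeff_eq_zero_of_natDegree_lt {p : SkewPoly σ} {i : ℕ} (h : natDegree p < i) :
    coeff p i = 0 :=
  natDegree_le_iff.1 le_rfl i h

theorem natDegree_eq {p : SkewPoly σ} {d : ℕ} (hd : coeff p d ≠ 0)
    (h : ∀ i, d < i → coeff p i = 0) : natDegree p = d :=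
  le_antisymm (natDegree_le_iff.2 h) (not_lt.1 fun hlt => hd (coeff_eq_zero_of_natDegree_lt hlt))

theorem coeff_natDegree_ne_zero {p : SkewPoly σ} (hp : p ≠ 0) : coeff p (natDegree p) ≠ 0 := by
  obtain ⟨i, hi, h⟩ := exists_mem_eq_sup _
    (nonempty_iff_ne_empty.2 fun h => hp (SkewPolynomial.support_eq_empty.1 h)) (id : ℕ → ℕ)
  rw [natDegree, h]
  exact SkewPolynomial.mem_support_iff.1 hi

theorem coeff_mul_natDegree (p q : SkewPoly σ) :
    coeff (p * q) (natDegree p + natDegree q) =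
      coeff p (natDegree p) * (σ ^ natDegree p : K ≃+* K) (coeff q (natDegree q)) :=
  coeff_mul_add (fun _ => coeff_eq_zero_of_natDegree_lt) fun _ => coeff_eq_zero_of_natDegree_lt

theorem coeff_mul_natDegree_ne_zero {p q : SkewPoly σ} (hp : p ≠ 0) (hq : q ≠ 0) :
    coeff (p * q) (natDegree p + natDegree q) ≠ 0 := by
  rw [coeff_mul_natDegree]
  exact mul_ne_zero (coeff_natDegree_ne_zero hp) <|
    (map_ne_zero_iff _ (RingEquiv.injective _)).2 (coeff_natDegree_ne_zero hq)

theorem natDegree_mul {p q : SkewPoly σ} (hp : p ≠ 0) (hq : q ≠ 0) :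
    natDegree (p * q) = natDegree p + natDegree q :=
  natDegree_eq (coeff_mul_natDegree_ne_zero hp hq) fun _ => coeff_mul_of_lt
    (fun _ => coeff_eq_zero_of_natDegree_lt) fun _ => coeff_eq_zero_of_natDegree_lt

instance : NoZeroDivisors (SkewPoly σ) where
  eq_zero_or_eq_zero_of_mul_eq_zero {p q} h := by
    by_contra! hpq
    exact coeff_mul_natDegree_ne_zero hpq.1 hpq.2 (by rw [h, map_zero, Pi.zero_apply])

theorem natDegree_const (a : K) : natDegree (const σ a) = 0 :=
  Nat.le_zero.1 <| natDegree_le_iff.2 fun i hi => by rw [coeff_const, if_neg hi.ne']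

theorem ne_zero_of_natDegree_pos {p : SkewPoly σ} (h : 0 < natDegree p) : p ≠ 0 := by
  rintro rfl
  exact h.ne rfl

theorem eq_const_of_natDegree_eq_zero {p : SkewPoly σ} (h : natDegree p = 0) :
    p = const σ (coeff p 0) := by
  have := sum_const_coeff_mul_t_pow (p := p) (d := 1) fun i hi =>
    coeff_eq_zero_of_natDegree_lt (h ▸ hi)
  simpa using this.symm

theorem isUnit_iff_natDegree_eq_zero {p : SkewPoly σ} (hp : p ≠ 0) :
    IsUnit p ↔ natDegree p = 0 := by
  refine ⟨fun h => ?_, fun h => ?_⟩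
  · obtain ⟨q, hpq⟩ := h.exists_right_inv
    have hq : q ≠ 0 := by rintro rfl; simp at hpq
    have hdeg := natDegree_mul hp hq
    rw [hpq, ← map_one (const σ), natDegree_const] at hdeg
    omega
  · rw [eq_const_of_natDegree_eq_zero h] at hp ⊢
    exact (IsUnit.mk0 _ fun h0 => hp (by rw [h0, map_zero])).map (const σ)

theorem natDegree_le_of_mem_span {f p : SkewPoly σ} (hp : p ∈ Ideal.span {f}) (hp0 : p ≠ 0) :
    natDegree f ≤ natDegree p := by
  obtain ⟨q, rfl⟩ := Ideal.mem_span_singleton'.1 hp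
  rw [natDegree_mul (left_ne_zero_of_mul hp0) (right_ne_zero_of_mul hp0)]
  exact Nat.le_add_left _ _

end Degree

section DegreeLT

variable (σ) in
/-- The skew polynomials with no term `tⁱ` for `i ≥ d`, as an additive group. -/
def degreeLT (d : ℕ) : AddSubgroup (SkewPoly σ) where
  carrier := {p | ∀ i, d ≤ i → coeff p i = 0}
  zero_mem' i _ := by simp
  add_mem' hp hq i hi := by simp [hp i hi, hq i hi]
  neg_mem' hp i hi := by simp [hp i hi]

theorem natDegree_lt_of_mem_degreeLT {d : ℕ} {p : SkewPoly σ} (hp : p ∈ degreeLT σ d)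
    (hp0 : p ≠ 0) : natDegree p < d := by
  by_contra! h
  exact coeff_natDegree_ne_zero hp0 (hp _ h)

theorem mem_degreeLT_of_natDegree_lt {d : ℕ} {p : SkewPoly σ} (h : natDegree p < d) :
    p ∈ degreeLT σ d := fun _ hi => coeff_eq_zero_of_natDegree_lt (h.trans_le hi)

theorem const_mul_mem_degreeLT {d : ℕ} {p : SkewPoly σ} (a : K) (hp : p ∈ degreeLT σ d) :
    const σ a * p ∈ degreeLT σ d := fun i hi => by rw [coeff_const_mul, hp i hi, mul_zero]

theorem mul_const_mem_degreeLT {d : ℕ} {p : SkewPoly σ} (hp : p ∈ degreeLT σ d) (a : K) :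
    p * const σ a ∈ degreeLT σ d := fun i hi => by rw [coeff_mul_const, hp i hi, zero_mul]

theorem eq_zero_of_mem_degreeLT_of_mem_span {f p : SkewPoly σ}
    (hp : p ∈ degreeLT σ (natDegree f)) (hpf : p ∈ Ideal.span {f}) : p = 0 := by
  by_contra hp0
  exact (natDegree_lt_of_mem_degreeLT hp hp0).not_ge (natDegree_le_of_mem_span hpf hp0)

theorem exists_sub_const_mul_mul_mem_degreeLT {f p : SkewPoly σ} (hf : f ≠ 0) {k : ℕ}
    (hp : p ∈ degreeLT σ (k + natDegree f + 1)) :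
    ∃ c : K, p - const σ c * t σ ^ k * f ∈ degreeLT σ (k + natDegree f) := by
  have hlead : (σ ^ k : K ≃+* K) (coeff f (natDegree f)) ≠ 0 :=
    (map_ne_zero_iff _ (RingEquiv.injective _)).2 (coeff_natDegree_ne_zero hf)
  have hk (i : ℕ) (hi : k < i) : coeff (t σ ^ k) i = 0 := by rw [coeff_t_pow, if_neg hi.ne']
  refine ⟨coeff p (k + natDegree f) / (σ ^ k : K ≃+* K) (coeff f (natDegree f)), fun i hi => ?_⟩
  rw [map_sub, Pi.sub_apply, mul_assoc, coeff_const_mul]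
  rcases hi.eq_or_lt with rfl | hi
  · rw [coeff_mul_add hk fun _ => coeff_eq_zero_of_natDegree_lt, coeff_t_pow, if_pos rfl, one_mul,
      div_mul_cancel₀ _ hlead, sub_self]
  · rw [hp i hi, coeff_mul_of_lt hk (fun _ => coeff_eq_zero_of_natDegree_lt) hi, mul_zero, sub_zero]

theorem exists_mem_degreeLT_sub_mem_span {f : SkewPoly σ} (hf : f ≠ 0) (p : SkewPoly σ) :
    ∃ r ∈ degreeLT σ (natDegree f), p - r ∈ Ideal.span {f} := by
  have hdiv (k : ℕ) : ∀ p ∈ degreeLT σ (k + natDegree f),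
      ∃ r ∈ degreeLT σ (natDegree f), p - r ∈ Ideal.span {f} := by
    induction k with
    | zero => exact fun p hp => ⟨p, by rwa [zero_add] at hp, by simp⟩
    | succ k ih =>
      intro p hp
      obtain ⟨c, hc⟩ := exists_sub_const_mul_mul_mem_degreeLT hf (p := p) (k := k) (by
        rwa [add_right_comm] at hp)
      obtain ⟨r, hr, hmem⟩ := ih _ hc
      refine ⟨r, hr, ?_⟩
      rw [sub_right_comm] at hmem
      simpa using add_mem hmem (Ideal.mul_mem_left _ (const σ c * t σ ^ k)
        (Ideal.mem_span_singleton_self f))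
  exact hdiv (natDegree p + 1) p (mem_degreeLT_of_natDegree_lt (by omega))

end DegreeLT

section Monic

theorem isMonic_iff {p : SkewPoly σ} : IsMonic p ↔ coeff p (natDegree p) = 1 := Iff.rfl

theorem IsMonic.ne_zero {p : SkewPoly σ} (h : IsMonic p) : p ≠ 0 := by
  rintro rfl
  exact zero_ne_one (α := K) (isMonic_iff.1 h)

theorem exists_eq_const_mul_isMonic {p : SkewPoly σ} (hp : p ≠ 0) :
    ∃ (u : Kˣ) (g : SkewPoly σ), IsMonic g ∧ natDegree g = natDegree p ∧ p = const σ u * g := by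
  have hu := coeff_natDegree_ne_zero hp
  set u := coeff p (natDegree p)
  have hdeg : natDegree (const σ u⁻¹ * p) = natDegree p := natDegree_eq
    (by rw [coeff_const_mul]; exact mul_ne_zero (inv_ne_zero hu) hu)
    fun i hi => by rw [coeff_const_mul, coeff_eq_zero_of_natDegree_lt hi, mul_zero]
  refine ⟨Units.mk0 u hu, const σ u⁻¹ * p, ?_, hdeg, ?_⟩
  · rw [isMonic_iff, hdeg, coeff_const_mul, inv_mul_cancel₀ hu]
  · rw [Units.val_mk0, ← mul_assoc, ← map_mul, mul_inv_cancel₀ hu, map_one, one_mul]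

theorem IsMonic.mul {p q : SkewPoly σ} (hp : IsMonic p) (hq : IsMonic q) : IsMonic (p * q) := by
  rw [isMonic_iff, natDegree_mul hp.ne_zero hq.ne_zero, coeff_mul_natDegree, isMonic_iff.1 hp,
    isMonic_iff.1 hq, map_one, mul_one]

theorem IsMonic.eq_one_of_natDegree_eq_zero {p : SkewPoly σ} (hp : IsMonic p)
    (h : natDegree p = 0) : p = 1 := by
  rw [eq_const_of_natDegree_eq_zero h, ← h, isMonic_iff.1 hp, map_one]

theorem IsMonic.eq_of_mem_span {f g : SkewPoly σ} (hf : IsMonic f) (hg : IsMonic g)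
    (hgf : g ∈ Ideal.span {f}) (hdeg : natDegree g ≤ natDegree f) : g = f := by
  have hdeg' := hdeg.antisymm (natDegree_le_of_mem_span hgf hg.ne_zero)
  rw [← sub_eq_zero]
  refine eq_zero_of_mem_degreeLT_of_mem_span (f := f) (fun i hi => ?_)
    (sub_mem hgf (Ideal.mem_span_singleton_self f))
  rw [map_sub, Pi.sub_apply]
  rcases hi.eq_or_lt with rfl | hi
  · rw [isMonic_iff.1 hf, ← hdeg', isMonic_iff.1 hg, sub_self]
  · rw [coeff_eq_zero_of_natDegree_lt hi, coeff_eq_zero_of_natDegree_lt (hdeg.trans_lt hi),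
      sub_zero]

theorem IsMonic.eq_t_sub_const {p : SkewPoly σ} (hp : IsMonic p) (h : natDegree p = 1) :
    p = t σ - const σ (-coeff p 0) := by
  rw [isMonic_iff, h] at hp
  have hsum := sum_const_coeff_mul_t_pow (p := p) (d := 2) fun i hi =>
    coeff_eq_zero_of_natDegree_lt (h ▸ hi)
  rw [sum_range_succ, sum_range_one, hp, pow_zero, mul_one, pow_one, map_one, one_mul] at hsum
  rw [map_neg, sub_neg_eq_add, add_comm, hsum]

theorem coeff_t_pow_sub_const {k : ℕ} (hk : 0 < k) (a : K) :
    coeff (t σ ^ k - const σ a) k = 1 := by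
  rw [map_sub, Pi.sub_apply, coeff_t_pow, if_pos rfl, coeff_const, if_neg hk.ne', sub_zero]

theorem natDegree_t_pow_sub_const {k : ℕ} (hk : 0 < k) (a : K) :
    natDegree (t σ ^ k - const σ a) = k := by
  refine natDegree_eq (by rw [coeff_t_pow_sub_const hk]; exact one_ne_zero) fun i hi => ?_
  rw [map_sub, Pi.sub_apply, coeff_t_pow, if_neg hi.ne', coeff_const,
    if_neg (hk.trans hi).ne', sub_zero]

theorem isMonic_t_pow_sub_const {k : ℕ} (hk : 0 < k) (a : K) :
    IsMonic (t σ ^ k - const σ a) := by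
  rw [isMonic_iff, natDegree_t_pow_sub_const hk, coeff_t_pow_sub_const hk]

end Monic

instance : IsPrincipalIdealRing (SkewPoly σ) where
  principal I := by
    rcases eq_or_ne I ⊥ with rfl | hI
    · exact bot_isPrincipal
    obtain ⟨f, ⟨hfI, hf⟩, hmin⟩ := exists_minimalFor_of_wellFoundedLT
      (fun p : SkewPoly σ => p ∈ I ∧ p ≠ 0) natDegree (Submodule.exists_mem_ne_zero_of_ne_bot hI)
    refine ⟨f, le_antisymm (fun p hp => ?_) ((Ideal.span_singleton_le_iff_mem I).2 hfI)⟩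
    obtain ⟨r, hr, hpr⟩ := exists_mem_degreeLT_sub_mem_span hf p
    have hrI : r ∈ I := by
      simpa using sub_mem hp ((Ideal.span_singleton_le_iff_mem I).2 hfI hpr)
    obtain rfl : r = 0 := by
      by_contra hr0
      have hlt := natDegree_lt_of_mem_degreeLT hr hr0
      exact hlt.not_ge (hmin ⟨hrI, hr0⟩ hlt.le)
    simpa using hpr

section FixedField

theorem isGaloisGroup_zpowers (σ : K ≃+* K) :
    IsGaloisGroup (Subgroup.zpowers (σ : RingAut K)) (fixedField σ) K where
  faithful := ⟨fun {g h} H => Subtype.ext (RingEquiv.ext H)⟩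
  commutes := by
    refine ⟨fun ⟨g, hg⟩ a x => ?_⟩
    have hga : g (a : K) = a :=
      (Subgroup.zpowers_le (H := MulAction.stabilizer (RingAut K) (a : K))).2 a.2 hg
    exact (map_mul g (a : K) x).trans (congrArg (· * g x) hga)
  isInvariant := ⟨fun b hb => ⟨⟨b, hb ⟨σ, Subgroup.mem_zpowers σ⟩⟩, rfl⟩⟩

theorem finite_fixedField (hσ : IsOfFinOrder σ) : Module.Finite (fixedField σ) K := by
  have : Finite (Subgroup.zpowers (σ : RingAut K)) := hσ.finite_zpowers
  have := isGaloisGroup_zpowers σ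
  exact IsGaloisGroup.finiteDimensional (Subgroup.zpowers (σ : RingAut K)) (fixedField σ) K

/-- The product `b σ(b) ⋯ σᵏ⁻¹(b)`, which is the norm of `b` over `Fix(σ)` when `k` is the order
of `σ`. -/
def partialNorm (σ : K ≃+* K) (k : ℕ) (b : K) : K := ∏ i ∈ range k, (σ ^ i : K ≃+* K) b

theorem partialNorm_succ (k : ℕ) (b : K) :
    partialNorm σ (k + 1) b = σ (partialNorm σ k b) * b := by
  rw [partialNorm, prod_range_succ', partialNorm, map_prod, pow_zero]
  simp only [pow_succ']
  rfl

theorem coe_norm (hσ : IsOfFinOrder σ) (b : K) :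
    (Algebra.norm (fixedField σ) b : K) = partialNorm σ (orderOf σ) b := by
  have : Finite (Subgroup.zpowers (σ : RingAut K)) := hσ.finite_zpowers
  have := isGaloisGroup_zpowers σ
  have := IsGaloisGroup.isGalois (Subgroup.zpowers (σ : RingAut K)) (fixedField σ) K
  have := finite_fixedField hσ
  rw [partialNorm, ← Fin.prod_univ_eq_prod_range (fun i => (σ ^ i : K ≃+* K) b)]
  refine (Algebra.norm_eq_prod_automorphisms (fixedField σ) b).trans (Eq.symm ?_)
  exact Fintype.prod_equiv ((finEquivZPowers hσ).trans
    (IsGaloisGroup.mulEquivAlgEquiv (Subgroup.zpowers (σ : RingAut K)) (fixedField σ) K).toEquiv)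
    _ _ fun i => rfl

theorem norm_map (hσ : IsOfFinOrder σ) (b : K) :
    Algebra.norm (fixedField σ) (σ b) = Algebra.norm (fixedField σ) b := by
  apply Subtype.ext
  refine Eq.trans ?_ (Algebra.norm (fixedField σ) b).2
  rw [coe_norm hσ, RingHom.coe_coe, coe_norm hσ, partialNorm, partialNorm, map_prod]
  exact prod_congr rfl fun i _ => DFunLike.congr_fun (pow_mul_comm' σ i) b

theorem norm_Omega (hσ : IsOfFinOrder σ) (c : Kˣ) (b : K) :
    Algebra.norm (fixedField σ) (Omega σ c b) = Algebra.norm (fixedField σ) b := by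
  have := finite_fixedField hσ
  rw [Omega, map_mul, map_mul, norm_map hσ, mul_right_comm, ← map_mul, mul_inv_cancel₀ c.ne_zero,
    map_one, one_mul]

end FixedField

section Quotient

variable (σ) in
/-- The `Fix(σ)`-linear map sending `c₀, …, c_{d-1}` to `∑ cᵢ tⁱ`. -/
def ofCoeffs (d : ℕ) : (Fin d → K) →ₗ[fixedField σ] SkewPoly σ where
  toFun c := ∑ i : Fin d, const σ (c i) * t σ ^ (i : ℕ)
  map_add' c c' := by simp [add_mul, sum_add_distrib]
  map_smul' a c := by
    simp only [Pi.smul_apply, map_mul, mul_assoc, RingHom.id_apply,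
      Algebra.smul_def, mul_sum]
    rfl

theorem coeff_ofCoeffs {d : ℕ} (c : Fin d → K) (i : ℕ) :
    coeff (ofCoeffs σ d c) i = if h : i < d then c ⟨i, h⟩ else 0 := by
  simp only [ofCoeffs, LinearMap.coe_mk, AddHom.coe_mk, map_sum, Finset.sum_apply,
    coeff_const_mul_t_pow]
  split_ifs with h
  · rw [sum_eq_single_of_mem ⟨i, h⟩ (mem_univ _) fun j _ hj =>
      if_neg fun hij => hj (Fin.ext hij.symm), if_pos rfl]
  · exact sum_eq_zero fun j _ => if_neg (by omega)

theorem ofCoeffs_mem_degreeLT {d : ℕ} (c : Fin d → K) : ofCoeffs σ d c ∈ degreeLT σ d :=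
  fun i hi => by rw [coeff_ofCoeffs, dif_neg hi.not_gt]

theorem ofCoeffs_injective (d : ℕ) : Function.Injective (ofCoeffs σ d) := fun c c' h =>
  funext fun i => by simpa [coeff_ofCoeffs] using congr_fun (congr_arg coeff h) i

theorem exists_ofCoeffs_eq {d : ℕ} {p : SkewPoly σ} (hp : p ∈ degreeLT σ d) :
    ∃ c, ofCoeffs σ d c = p :=
  ⟨fun i => coeff p i, (sum_range fun i => const σ (coeff p i) * t σ ^ i).symm.trans
    (sum_const_coeff_mul_t_pow hp)⟩

/-- Division with remainder by `f`, as an isomorphism of `Fix(σ)`-vector spaces. -/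
def quotientEquiv {f : SkewPoly σ} (hf : f ≠ 0) :
    (Fin (natDegree f) → K) ≃ₗ[fixedField σ] SkewPoly σ ⧸ Ideal.span {f} :=
  LinearEquiv.ofBijective
    (((Ideal.span {f}).mkQ.restrictScalars (fixedField σ)).comp (ofCoeffs σ (natDegree f))) <| by
    refine ⟨(injective_iff_map_eq_zero _).2 fun c hc => ?_, fun x => ?_⟩
    · exact (map_eq_zero_iff _ (ofCoeffs_injective _)).1 <| eq_zero_of_mem_degreeLT_of_mem_span
        (ofCoeffs_mem_degreeLT c) ((Submodule.Quotient.mk_eq_zero _).1 hc)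
    · obtain ⟨p, rfl⟩ := Submodule.Quotient.mk_surjective _ x
      obtain ⟨r, hr, hpr⟩ := exists_mem_degreeLT_sub_mem_span hf p
      obtain ⟨c, rfl⟩ := exists_ofCoeffs_eq hr
      exact ⟨c, ((Submodule.Quotient.eq _).2 hpr).symm⟩

theorem finite_quotient (hσ : IsOfFinOrder σ) {f : SkewPoly σ} (hf : f ≠ 0) :
    Module.Finite (fixedField σ) (SkewPoly σ ⧸ Ideal.span {f}) :=
  have := finite_fixedField hσ
  .equiv (quotientEquiv hf)

theorem finrank_quotient (hσ : IsOfFinOrder σ) {f : SkewPoly σ} (hf : f ≠ 0) :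
    Module.finrank (fixedField σ) (SkewPoly σ ⧸ Ideal.span {f}) =
      natDegree f * Module.finrank (fixedField σ) K := by
  have := finite_fixedField hσ
  rw [← (quotientEquiv hf).finrank_eq, Module.finrank_pi_fintype, sum_const, card_univ,
    Fintype.card_fin, smul_eq_mul]

end Quotient

theorem mul_const_sub_mem_degreeLT (p : SkewPoly σ) (k : K) :
    p * const σ k - const σ ((σ ^ natDegree p : K ≃+* K) k) * p ∈ degreeLT σ (natDegree p) := by
  intro i hi
  rw [map_sub, Pi.sub_apply, coeff_mul_const, coeff_const_mul, mul_comm, sub_eq_zero]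
  rcases hi.eq_or_lt with rfl | hi
  · rfl
  · rw [coeff_eq_zero_of_natDegree_lt hi, mul_zero, mul_zero]

theorem const_mem_degreeLT {d : ℕ} (hd : 0 < d) (a : K) : const σ a ∈ degreeLT σ d :=
  mem_degreeLT_of_natDegree_lt (by rwa [natDegree_const])

theorem span_ne_top {f : SkewPoly σ} (hf : 0 < natDegree f) : Ideal.span {f} ≠ ⊤ := fun h => by
  have hdeg := natDegree_le_of_mem_span ((Ideal.eq_top_iff_one _).1 h) one_ne_zero
  rw [← map_one (const σ), natDegree_const] at hdeg
  exact hf.not_ge hdeg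

section CyclicAlgebra

theorem commute_t_pow_orderOf (p : SkewPoly σ) : Commute (t σ ^ orderOf σ) p := by
  rw [← sum_const_coeff_mul_t_pow (d := natDegree p + 1) fun i hi =>
    coeff_eq_zero_of_natDegree_lt (Nat.lt_of_succ_le hi)]
  refine Commute.sum_right _ _ _ fun i _ => Commute.mul_right ?_ (Commute.pow_pow_self _ _ _)
  rw [commute_iff_eq, t_pow_mul_const, pow_orderOf_eq_one, RingAut.one_apply]

theorem exists_eq_const_mul_t_pow {p : SkewPoly σ} (hp : p ∈ degreeLT σ (orderOf σ)) {d : ℕ}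
    (hd : d < orderOf σ) (h : ∀ k, p * const σ k = const σ ((σ ^ d : K ≃+* K) k) * p) :
    ∃ c, p = const σ c * t σ ^ d := by
  refine ⟨coeff p d, coeff_injective (funext fun i => ?_)⟩
  rw [coeff_const_mul_t_pow]
  split_ifs with hid
  · rw [hid]
  rcases le_or_gt (orderOf σ) i with hi | hi
  · exact hp i hi
  have hne : σ ^ i ≠ σ ^ d := fun h => hid (pow_injOn_Iio_orderOf hi hd h)
  obtain ⟨k, hk⟩ := DFunLike.ne_iff.1 hne
  have hcoeff := congr_fun (congr_arg coeff (h k)) i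
  rw [coeff_mul_const, coeff_const_mul, mul_comm] at hcoeff
  exact (mul_eq_zero.1 (by rw [sub_mul, hcoeff, sub_self])).resolve_left (sub_ne_zero.2 hk)

/-- The central polynomial `tⁿ - a`, where `n` is the order of `σ` and `a ∈ Fix(σ)`. -/
def centralBinomial (a : fixedField σ) : SkewPoly σ := t σ ^ orderOf σ - const σ a

theorem commute_centralBinomial (a : fixedField σ) (p : SkewPoly σ) :
    Commute (centralBinomial a) p :=
  (commute_t_pow_orderOf p).sub_left (const_fixed_commutes σ a p)

theorem isMonic_centralBinomial (hσ : IsOfFinOrder σ) (a : fixedField σ) :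
    IsMonic (centralBinomial a) := isMonic_t_pow_sub_const hσ.orderOf_pos _

theorem natDegree_centralBinomial (hσ : IsOfFinOrder σ) (a : fixedField σ) :
    natDegree (centralBinomial a) = orderOf σ := natDegree_t_pow_sub_const hσ.orderOf_pos _

theorem natDegree_le_orderOf (hσ : IsOfFinOrder σ) {f : SkewPoly σ} {a : fixedField σ}
    (haf : centralBinomial a ∈ Ideal.span {f}) : natDegree f ≤ orderOf σ :=
  (natDegree_le_of_mem_span haf (isMonic_centralBinomial hσ a).ne_zero).trans_eq
    (natDegree_centralBinomial hσ a)

instance (a : fixedField σ) : (Ideal.span {centralBinomial a}).IsTwoSided where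
  mul_mem_of_left {x} y hx := by
    obtain ⟨q, rfl⟩ := Ideal.mem_span_singleton'.1 hx
    rw [mul_assoc, commute_centralBinomial a y, ← mul_assoc]
    exact Ideal.mul_mem_left _ _ (Ideal.mem_span_singleton_self _)

/-- The cyclic algebra `(K / Fix(σ), σ, a)`, generated over `K` by an element `t` with `tⁿ = a`. -/
abbrev CyclicAlgebra (a : fixedField σ) : Type _ := SkewPoly σ ⧸ Ideal.span {centralBinomial a}

namespace CyclicAlgebra

variable {a : fixedField σ}

theorem exists_mk_eq (hσ : IsOfFinOrder σ) (x : CyclicAlgebra a) :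
    ∃ p ∈ degreeLT σ (orderOf σ), Ideal.Quotient.mk _ p = x := by
  obtain ⟨p, rfl⟩ := Ideal.Quotient.mk_surjective x
  obtain ⟨r, hr, hpr⟩ := exists_mem_degreeLT_sub_mem_span (isMonic_centralBinomial hσ a).ne_zero p
  rw [natDegree_centralBinomial hσ] at hr
  exact ⟨r, hr, (Ideal.Quotient.eq.2 hpr).symm⟩

theorem mk_injOn (hσ : IsOfFinOrder σ) : Set.InjOn
    (Ideal.Quotient.mk (Ideal.span {centralBinomial a})) (degreeLT σ (orderOf σ)) := by
  intro p hp q hq h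
  rw [← sub_eq_zero]
  refine eq_zero_of_mem_degreeLT_of_mem_span (f := centralBinomial a) ?_ (Ideal.Quotient.eq.1 h)
  rw [natDegree_centralBinomial hσ]
  exact sub_mem hp hq

theorem isUnit_mk_t (hσ : IsOfFinOrder σ) (ha : a ≠ 0) :
    IsUnit (Ideal.Quotient.mk (Ideal.span {centralBinomial a}) (t σ)) := by
  rw [← isUnit_pow_iff hσ.orderOf_pos.ne', ← map_pow,
    Ideal.Quotient.eq.2 (Ideal.mem_span_singleton_self (centralBinomial a) :
      t σ ^ orderOf σ - const σ a ∈ _)]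
  exact ((Units.mk0 a ha).isUnit.map (algebraMap (fixedField σ) (SkewPoly σ))).map _

theorem eq_top_of_isTwoSided (hσ : IsOfFinOrder σ) (ha : a ≠ 0) {I : Ideal (CyclicAlgebra a)}
    [I.IsTwoSided] (hI : I ≠ ⊥) : I = ⊤ := by
  obtain ⟨x, hxI, hx⟩ := Submodule.exists_mem_ne_zero_of_ne_bot hI
  obtain ⟨p₀, hp₀, rfl⟩ := exists_mk_eq hσ x
  obtain ⟨p, ⟨hp, hp0, hpI⟩, hmin⟩ := exists_minimalFor_of_wellFoundedLT
    (fun p => p ∈ degreeLT σ (orderOf σ) ∧ p ≠ 0 ∧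
      Ideal.Quotient.mk (Ideal.span {centralBinomial a}) p ∈ I) natDegree
    ⟨p₀, hp₀, fun h => hx (by rw [h, map_zero]), hxI⟩
  have hcomm (k : K) : p * const σ k = const σ ((σ ^ natDegree p : K ≃+* K) k) * p := by
    rw [← sub_eq_zero]
    by_contra hne
    have hlt := natDegree_lt_of_mem_degreeLT (mul_const_sub_mem_degreeLT p k) hne
    refine hlt.not_ge (hmin ⟨sub_mem (mul_const_mem_degreeLT hp k) (const_mul_mem_degreeLT _ hp),
      hne, ?_⟩ hlt.le)
    rw [map_sub, map_mul, map_mul]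
    exact sub_mem (Ideal.mul_mem_right _ _ hpI) (Ideal.mul_mem_left _ _ hpI)
  obtain ⟨c, hc⟩ := exists_eq_const_mul_t_pow hp (natDegree_lt_of_mem_degreeLT hp hp0) hcomm
  have hc0 : c ≠ 0 := fun h => hp0 (by rw [hc, h, map_zero, zero_mul])
  refine Ideal.eq_top_of_isUnit_mem _ hpI ?_
  rw [hc, map_mul, map_pow]
  exact (((IsUnit.mk0 c hc0).map (const σ)).map _).mul ((isUnit_mk_t hσ ha).pow _)

theorem isSimpleRing (hσ : IsOfFinOrder σ) (ha : a ≠ 0) : IsSimpleRing (CyclicAlgebra a) := by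
  refine isSimpleRing_iff_isTwoSided_imp.2 ⟨?_, fun I _ =>
    or_iff_not_imp_left.2 (eq_top_of_isTwoSided hσ ha)⟩
  refine Submodule.Quotient.nontrivial_iff.2 ?_
  exact span_ne_top (by rw [natDegree_centralBinomial hσ]; exact hσ.orderOf_pos)

theorem isCentral (hσ : IsOfFinOrder σ) (ha : a ≠ 0) :
    Algebra.IsCentral (fixedField σ) (CyclicAlgebra a) where
  out x hx := by
    have hx' := Subalgebra.mem_center_iff.1 hx
    obtain ⟨p, hp, rfl⟩ := exists_mk_eq hσ x
    obtain ⟨c, rfl⟩ : ∃ c, p = const σ c := by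
      refine (exists_eq_const_mul_t_pow hp hσ.orderOf_pos fun k => ?_).imp fun c hc => by
        rwa [pow_zero, mul_one] at hc
      refine mk_injOn (a := a) hσ (mul_const_mem_degreeLT hp k) (const_mul_mem_degreeLT _ hp) ?_
      rw [map_mul, map_mul, ← hx', pow_zero, RingAut.one_apply]
    have hc : σ c = c := by
      have h := hx' (Ideal.Quotient.mk _ (t σ))
      rw [← map_mul, t_mul_const, map_mul] at h
      exact (const σ).injective <| mk_injOn hσ (const_mem_degreeLT hσ.orderOf_pos _)
        (const_mem_degreeLT hσ.orderOf_pos _) ((isUnit_mk_t hσ ha).mul_right_cancel h)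
    exact ⟨⟨c, hc⟩, rfl⟩

theorem finite (hσ : IsOfFinOrder σ) : Module.Finite (fixedField σ) (CyclicAlgebra a) :=
  finite_quotient hσ (isMonic_centralBinomial hσ a).ne_zero

end CyclicAlgebra

theorem ker_mkₐ_centralBinomial_le {f : SkewPoly σ} {a : fixedField σ}
    (haf : centralBinomial a ∈ Ideal.span {f}) :
    RingHom.ker (Ideal.Quotient.mkₐ (fixedField σ) (Ideal.span {centralBinomial a})) ≤
      Ideal.span {f} := by
  change RingHom.ker (Ideal.Quotient.mk _) ≤ _
  rwa [Ideal.mk_ker, Ideal.span_singleton_le_iff_mem]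

theorem isGeneralisedAPolynomial_of_centralBinomial_mem (hσ : IsOfFinOrder σ) {f : SkewPoly σ}
    (hf : 0 < natDegree f) {a : fixedField σ} (ha : a ≠ 0)
    (haf : centralBinomial a ∈ Ideal.span {f}) : IsGeneralisedAPolynomial f := by
  have := CyclicAlgebra.finite (a := a) hσ
  have := CyclicAlgebra.isSimpleRing hσ ha
  have := CyclicAlgebra.isCentral hσ ha
  obtain ⟨hfinite, hcentral, hsimple⟩ := Eigenring.finite_isCentral_isSimpleRing_of_surjective
    (span_ne_top hf) (Ideal.Quotient.mkₐ (fixedField σ) (Ideal.span {centralBinomial a}))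
    (Ideal.Quotient.mkₐ_surjective _ _) (ker_mkₐ_centralBinomial_le haf)
  exact ⟨hfinite, hcentral, hsimple⟩

theorem exists_centralBinomial_mem {f : SkewPoly σ}
    (h : Algebra.IsCentral (fixedField σ) (Eigenring (fixedField σ) f)) :
    ∃ a : fixedField σ, centralBinomial a ∈ Ideal.span {f} := by
  let x : idealiser (fixedField σ) f := ⟨t σ ^ orderOf σ, by
    rw [Eigenring.mem_idealiser, ← commute_t_pow_orderOf f]
    exact Ideal.mul_mem_left _ _ (Ideal.mem_span_singleton_self f)⟩
  obtain ⟨a, ha⟩ := h.out (x := Ideal.Quotient.mk _ x) <| Subalgebra.mem_center_iff.2 fun y => by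
    obtain ⟨y, rfl⟩ := Ideal.Quotient.mk_surjective y
    rw [← map_mul, ← map_mul]
    exact congrArg _ (Subtype.ext (commute_t_pow_orderOf (y : SkewPoly σ)).symm)
  refine ⟨a, (Eigenring.mk_eq_zero_iff (x := x - algebraMap (fixedField σ) _ a)).1 ?_⟩
  rw [map_sub, sub_eq_zero]
  exact ha.symm

end CyclicAlgebra

section LinearFactors

theorem natDegree_t_sub_const (a : K) : natDegree (t σ - const σ a) = 1 := by
  simpa using natDegree_t_pow_sub_const (σ := σ) one_pos a

theorem isMonic_t_sub_const (a : K) : IsMonic (t σ - const σ a) := by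
  simpa using isMonic_t_pow_sub_const (σ := σ) one_pos a

theorem t_pow_sub_partialNorm_mem_span (b : K) (k : ℕ) :
    t σ ^ k - const σ (partialNorm σ k b) ∈ Ideal.span {t σ - const σ b} := by
  induction k with
  | zero => simp [partialNorm]
  | succ k ih =>
    have hsplit : t σ ^ (k + 1) - const σ (partialNorm σ (k + 1) b) =
        t σ * (t σ ^ k - const σ (partialNorm σ k b)) +
          const σ (σ (partialNorm σ k b)) * (t σ - const σ b) := by
      rw [partialNorm_succ, mul_sub, mul_sub, t_mul_const, map_mul, pow_succ',
        sub_add_sub_cancel]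
    rw [hsplit]
    exact add_mem (Ideal.mul_mem_left _ _ ih)
      (Ideal.mul_mem_left _ _ (Ideal.mem_span_singleton_self _))

theorem centralBinomial_norm_mem_span (hσ : IsOfFinOrder σ) (b : K) :
    centralBinomial (Algebra.norm (fixedField σ) b) ∈ Ideal.span {t σ - const σ b} := by
  rw [centralBinomial, coe_norm hσ]
  exact t_pow_sub_partialNorm_mem_span b _

theorem eq_norm_of_centralBinomial_mem_span (hσ : IsOfFinOrder σ) {a : fixedField σ} {b : K}
    (h : centralBinomial a ∈ Ideal.span {t σ - const σ b}) :
    a = Algebra.norm (fixedField σ) b := by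
  have hmem := sub_mem (centralBinomial_norm_mem_span hσ b) h
  rw [centralBinomial, centralBinomial, sub_sub_sub_cancel_left, ← map_sub] at hmem
  have hzero := eq_zero_of_mem_degreeLT_of_mem_span
    (const_mem_degreeLT (by rw [natDegree_t_sub_const]; exact one_pos) _) hmem
  rw [map_eq_zero, sub_eq_zero] at hzero
  exact Subtype.ext hzero

theorem exists_mul_eq_centralBinomial_norm (hσ : IsOfFinOrder σ) (b : K) :
    ∃ q, (t σ - const σ b) * q = centralBinomial (Algebra.norm (fixedField σ) b) := by
  obtain ⟨q, hq⟩ := Ideal.mem_span_singleton'.1 (centralBinomial_norm_mem_span hσ b)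
  refine ⟨q, mul_right_cancel₀ (isMonic_t_sub_const b).ne_zero ?_⟩
  rw [mul_assoc, hq, commute_centralBinomial]

theorem exists_mul_notMem_span (hσ : IsOfFinOrder σ) {f : SkewPoly σ} (hf : 0 < natDegree f)
    {a : fixedField σ} (ha : a ≠ 0) (haf : centralBinomial a ∈ Ideal.span {f}) {p : SkewPoly σ}
    (hp : p ∉ Ideal.span {centralBinomial a}) : ∃ g, p * g ∉ Ideal.span {f} := by
  have := CyclicAlgebra.isSimpleRing hσ ha
  have hker := ker_mkₐ_centralBinomial_le haf
  have hsurj := Ideal.Quotient.mkₐ_surjective (fixedField σ) (Ideal.span {centralBinomial a})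
  have htop := (span_singleton_map_eq_top_iff hsurj hker).not.2 (span_ne_top hf)
  obtain ⟨x, hx⟩ := exists_mul_notMem_of_ne_top htop
    (p := Ideal.Quotient.mkₐ (fixedField σ) _ p) (mt Ideal.Quotient.eq_zero_iff_mem.1 hp)
  obtain ⟨g, rfl⟩ := hsurj x
  exact ⟨g, by rwa [← map_mul, map_mem_span_singleton_iff hsurj hker] at hx⟩

theorem exists_linear_mul_mem_span (hσ : IsOfFinOrder σ) {f : SkewPoly σ} (hf : 0 < natDegree f)
    {b : K} (hb : b ≠ 0)
    (hbf : centralBinomial (Algebra.norm (fixedField σ) b) ∈ Ideal.span {f}) :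
    ∃ p ∈ degreeLT σ (natDegree f), p ≠ 0 ∧ (t σ - const σ b) * p ∈ Ideal.span {f} := by
  have := finite_fixedField hσ
  obtain ⟨q, hq⟩ := exists_mul_eq_centralBinomial_norm hσ b
  have hz0 := (isMonic_centralBinomial hσ (Algebra.norm (fixedField σ) b)).ne_zero
  have hq0 : q ≠ 0 := right_ne_zero_of_mul (hq ▸ hz0)
  have hqz : q ∉ Ideal.span {centralBinomial (Algebra.norm (fixedField σ) b)} := fun h => by
    have hle := natDegree_le_of_mem_span h hq0
    rw [← hq, natDegree_mul (isMonic_t_sub_const b).ne_zero hq0, natDegree_t_sub_const] at hle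
    omega
  obtain ⟨g, hg⟩ := exists_mul_notMem_span hσ hf (Algebra.norm_ne_zero_iff.2 hb) hbf hqz
  obtain ⟨r, hr, hgr⟩ := exists_mem_degreeLT_sub_mem_span (ne_zero_of_natDegree_pos hf) (q * g)
  refine ⟨r, hr, fun h0 => hg (by rwa [h0, sub_zero] at hgr), ?_⟩
  have hmem := sub_mem (Ideal.mul_mem_left _ g hbf) (Ideal.mul_mem_left _ (t σ - const σ b) hgr)
  rwa [← (commute_centralBinomial _ g).eq, ← hq, mul_assoc, ← mul_sub, sub_sub_cancel] at hmem

theorem linear_mul_const (b : K) (u : Kˣ) : (t σ - const σ b) * const σ u =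
    const σ (σ u) * (t σ - const σ (Omega σ u⁻¹ b)) := by
  have hΩ : σ u * Omega σ u⁻¹ b = b * u := by
    rw [Omega, ← mul_assoc, ← mul_assoc, ← map_mul, Units.mul_inv, map_one, one_mul,
      ← Units.val_inv_eq_inv_val, inv_inv]
  rw [sub_mul, mul_sub, t_mul_const, ← map_mul, ← map_mul, hΩ]

theorem exists_eq_linear_mul (hσ : IsOfFinOrder σ) {f : SkewPoly σ} (hmonic : IsMonic f)
    (hf : 0 < natDegree f) {b : K} (hb : b ≠ 0)
    (hbf : centralBinomial (Algebra.norm (fixedField σ) b) ∈ Ideal.span {f}) :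
    ∃ (c : Kˣ) (g : SkewPoly σ), IsMonic g ∧ f = (t σ - const σ (Omega σ c b)) * g := by
  obtain ⟨p, hp, hp0, hpf⟩ := exists_linear_mul_mem_span hσ hf hb hbf
  obtain ⟨u, g, hg, hgdeg, rfl⟩ := exists_eq_const_mul_isMonic hp0
  have hmem : (t σ - const σ (Omega σ u⁻¹ b)) * g ∈ Ideal.span {f} := by
    rw [← mul_assoc, linear_mul_const, mul_assoc] at hpf
    have hunit : IsUnit (const σ (σ u)) := (u.isUnit.map σ).map (const σ)
    exact (Ideal.unit_mul_mem_iff_mem _ hunit).1 hpf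
  refine ⟨u⁻¹, g, hg, (hmonic.eq_of_mem_span ((isMonic_t_sub_const _).mul hg) hmem ?_).symm⟩
  have hlt := natDegree_lt_of_mem_degreeLT hp hp0
  rw [natDegree_mul (isMonic_t_sub_const _).ne_zero hg.ne_zero, natDegree_t_sub_const, hgdeg]
  omega

theorem exists_eq_prod_linear (hσ : IsOfFinOrder σ) {b : K} (hb : b ≠ 0) {m : ℕ} :
    ∀ {f : SkewPoly σ}, IsMonic f → natDegree f = m →
      centralBinomial (Algebra.norm (fixedField σ) b) ∈ Ideal.span {f} →
      ∃ c : Fin m → Kˣ,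
        f = (List.ofFn fun i => t σ - const σ (Omega σ (c i) b)).prod := by
  induction m with
  | zero =>
    intro f hf hdeg _
    exact ⟨Fin.elim0, by rw [List.ofFn_zero, List.prod_nil, hf.eq_one_of_natDegree_eq_zero hdeg]⟩
  | succ m ih =>
    intro f hf hdeg hbf
    obtain ⟨c₀, g, hg, rfl⟩ := exists_eq_linear_mul hσ hf (by omega) hb hbf
    rw [natDegree_mul (isMonic_t_sub_const _).ne_zero hg.ne_zero, natDegree_t_sub_const] at hdeg
    obtain ⟨c, hc⟩ := ih hg (by omega) <| (Ideal.span_singleton_le_iff_mem _).2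
      (Ideal.mul_mem_left _ _ (Ideal.mem_span_singleton_self g)) hbf
    exact ⟨Fin.cons c₀ c, by simp [List.ofFn_succ, ← hc]⟩

theorem Omega_div_Omega (c d : Kˣ) (b : K) :
    Omega σ (c / d) (Omega σ d b) = Omega σ c b := by
  have hd : σ d ≠ 0 := (map_ne_zero_iff _ σ.injective).2 d.ne_zero
  simp only [Omega, Units.val_div_eq_div_val, map_div₀]
  field_simp

theorem Omega_ne_zero (c : Kˣ) {b : K} (hb : b ≠ 0) : Omega σ c b ≠ 0 :=
  mul_ne_zero (mul_ne_zero ((map_ne_zero_iff _ σ.injective).2 c.ne_zero) hb)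
    (inv_ne_zero c.ne_zero)

theorem exists_eq_normalised_prod_linear (hσ : IsOfFinOrder σ) {b : K} (hb : b ≠ 0)
    {f : SkewPoly σ} (hmonic : IsMonic f) (hf : 0 < natDegree f)
    (hbf : centralBinomial (Algebra.norm (fixedField σ) b) ∈ Ideal.span {f}) :
    ∃ (c : Fin (natDegree f) → Kˣ) (b : Kˣ),
      (∀ i : Fin (natDegree f), (i : ℕ) + 1 = natDegree f → c i = 1) ∧
      f = (List.ofFn fun i : Fin (natDegree f) =>
        t σ - const σ (Omega σ (c i) (b : K))).prod := by
  obtain ⟨c, hc⟩ := exists_eq_prod_linear hσ hb hmonic rfl hbf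
  let last : Fin (natDegree f) := ⟨natDegree f - 1, Nat.sub_one_lt_of_lt hf⟩
  refine ⟨fun i => c i / c last, Units.mk0 _ (Omega_ne_zero (σ := σ) (c last) hb),
    fun i hi => ?_, ?_⟩
  · exact div_eq_one.2 (congrArg c (Fin.ext (Nat.eq_sub_of_add_eq hi)))
  · simpa only [Units.val_mk0, Omega_div_Omega] using hc

end LinearFactors

section NonNorm

theorem natDegree_dvd_orderOf (hσ : IsOfFinOrder σ) {g : SkewPoly σ}
    (hg : (Ideal.span {g}).IsMaximal) {a : fixedField σ} (ha : a ≠ 0)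
    (hag : centralBinomial a ∈ Ideal.span {g}) : natDegree g ∣ orderOf σ := by
  have := CyclicAlgebra.finite (a := a) hσ
  have := CyclicAlgebra.isSimpleRing hσ ha
  have := finite_fixedField hσ
  have hz := (isMonic_centralBinomial hσ a).ne_zero
  have hg0 : g ≠ 0 := by
    rintro rfl
    exact hz (by simpa using hag)
  have hdvd := finrank_quotient_span_dvd
    (Ideal.Quotient.mkₐ (fixedField σ) (Ideal.span {centralBinomial a}))
    (Ideal.Quotient.mkₐ_surjective _ _) (ker_mkₐ_centralBinomial_le hag) hg
  rw [finrank_quotient hσ hg0, finrank_quotient hσ hz, natDegree_centralBinomial hσ] at hdvd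
  exact Nat.dvd_of_mul_dvd_mul_right Module.finrank_pos hdvd

theorem exists_eq_norm_of_natDegree_eq_one (hσ : IsOfFinOrder σ) {g : SkewPoly σ}
    (hg : natDegree g = 1) {a : fixedField σ} (hag : centralBinomial a ∈ Ideal.span {g}) :
    ∃ b : K, a = Algebra.norm (fixedField σ) b := by
  obtain ⟨u, p, hp, hpdeg, rfl⟩ := exists_eq_const_mul_isMonic
    (ne_zero_of_natDegree_pos (hg ▸ one_pos))
  refine ⟨-coeff p 0, eq_norm_of_centralBinomial_mem_span hσ ?_⟩
  rw [Ideal.span_singleton_mul_left_unit (u.isUnit.map (const σ))] at hag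
  rwa [← hp.eq_t_sub_const (hpdeg.trans hg)]

theorem natDegree_eq_orderOf (hn : (orderOf σ).Prime) {a : fixedField σ} (ha : a ≠ 0)
    (hnorm : ∀ b : K, a ≠ Algebra.norm (fixedField σ) b) {f : SkewPoly σ} (hf : 0 < natDegree f)
    (haf : centralBinomial a ∈ Ideal.span {f}) : natDegree f = orderOf σ := by
  have hσ : IsOfFinOrder σ := orderOf_pos_iff.1 hn.pos
  refine (natDegree_le_orderOf hσ haf).antisymm ?_
  obtain ⟨M, hM, hfM⟩ := Ideal.exists_le_maximal _ (span_ne_top hf)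
  obtain ⟨g, rfl⟩ := (IsPrincipalIdealRing.principal M).principal
  have hfg : f ∈ Ideal.span {g} := hfM (Ideal.mem_span_singleton_self f)
  rcases (Nat.dvd_prime hn).1 (natDegree_dvd_orderOf hσ hM ha (hfM haf)) with h | h
  · obtain ⟨b, hb⟩ := exists_eq_norm_of_natDegree_eq_one hσ h (hfM haf)
    exact absurd hb (hnorm b)
  · exact h ▸ natDegree_le_of_mem_span hfg (ne_zero_of_natDegree_pos hf)

theorem eq_centralBinomial (hn : (orderOf σ).Prime) {a : fixedField σ} (ha : a ≠ 0)
    (hnorm : ∀ b : K, a ≠ Algebra.norm (fixedField σ) b) {f : SkewPoly σ} (hmonic : IsMonic f)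
    (hf : 0 < natDegree f) (haf : centralBinomial a ∈ Ideal.span {f}) : f = centralBinomial a := by
  have hσ : IsOfFinOrder σ := orderOf_pos_iff.1 hn.pos
  refine (hmonic.eq_of_mem_span (isMonic_centralBinomial hσ a) haf ?_).symm
  rw [natDegree_centralBinomial hσ, natDegree_eq_orderOf hn ha hnorm hf haf]

theorem irreducible_centralBinomial (hn : (orderOf σ).Prime) {a : fixedField σ} (ha : a ≠ 0)
    (hnorm : ∀ b : K, a ≠ Algebra.norm (fixedField σ) b) : Irreducible (centralBinomial a) := by
  have hσ : IsOfFinOrder σ := orderOf_pos_iff.1 hn.pos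
  have hz := (isMonic_centralBinomial hσ a).ne_zero
  have hdeg := natDegree_centralBinomial hσ a
  refine ⟨fun h => hn.ne_zero (hdeg ▸ (isUnit_iff_natDegree_eq_zero hz).1 h), fun p q hpq => ?_⟩
  have hp : p ≠ 0 := left_ne_zero_of_mul (hpq ▸ hz)
  have hq : q ≠ 0 := right_ne_zero_of_mul (hpq ▸ hz)
  rw [isUnit_iff_natDegree_eq_zero hp, isUnit_iff_natDegree_eq_zero hq, or_iff_not_imp_right]
  intro hq0
  have hqdeg := natDegree_eq_orderOf hn ha hnorm (Nat.pos_of_ne_zero hq0)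
    (hpq ▸ Ideal.mul_mem_left _ p (Ideal.mem_span_singleton_self q))
  rw [hpq, natDegree_mul hp hq, hqdeg] at hdeg
  exact Nat.add_eq_right.1 hdeg

end NonNorm

section CentralMultiple

theorem t_pow_notMem_span {f : SkewPoly σ} (h0 : coeff f 0 ≠ 0) (hf : 0 < natDegree f) (k : ℕ) :
    t σ ^ k ∉ Ideal.span {f} := by
  intro h
  obtain ⟨q, hq⟩ := Ideal.mem_span_singleton'.1 h
  have hcoeff (i : ℕ) : i < k → coeff q i = 0 := by
    induction i using Nat.strong_induction_on with
    | h i ih =>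
      intro hi
      have hmul := coeff_mul_of_forall_lt (fun j hj => ih j hj (hj.trans hi)) f
      rw [hq, coeff_t_pow, if_neg hi.ne] at hmul
      exact (mul_eq_zero.1 hmul.symm).resolve_right
        ((map_ne_zero_iff _ (RingEquiv.injective _)).2 h0)
  have hq0 : q ≠ 0 := by
    rintro rfl
    simpa [coeff_t_pow] using congr_fun (congr_arg coeff hq) k
  have hlt := not_lt.1 fun hlt => coeff_natDegree_ne_zero hq0 (hcoeff _ hlt)
  have hlead := coeff_mul_natDegree_ne_zero hq0 (ne_zero_of_natDegree_pos hf)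
  rw [hq, coeff_t_pow, if_neg (by omega)] at hlead
  exact hlead rfl

theorem coeff_zero_ne_zero_of_isRightCoprime {f : SkewPoly σ} (hft : IsRightCoprime f (t σ)) :
    coeff f 0 ≠ 0 := by
  intro h0
  have ht : natDegree (t σ) = 1 := by simpa using natDegree_t_pow_sub_const (σ := σ) one_pos 0
  have ht0 : t σ ≠ 0 := ne_zero_of_natDegree_pos (ht ▸ one_pos)
  have hf : f ∈ Ideal.span {t σ} := by
    rw [← sum_const_coeff_mul_t_pow (d := natDegree f + 1) fun i hi =>
      coeff_eq_zero_of_natDegree_lt (Nat.lt_of_succ_le hi), sum_range_succ', h0, map_zero,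
      zero_mul, add_zero]
    refine sum_mem fun i _ => ?_
    rw [pow_succ, ← mul_assoc]
    exact Ideal.mul_mem_left _ _ (Ideal.mem_span_singleton_self _)
  have hunit := (isUnit_iff_natDegree_eq_zero ht0).1 (hft _ hf (Ideal.mem_span_singleton_self _))
  omega

theorem ne_zero_of_centralBinomial_mem_span {f : SkewPoly σ} (hft : IsRightCoprime f (t σ))
    (hf : 0 < natDegree f) {a : fixedField σ} (haf : centralBinomial a ∈ Ideal.span {f}) :
    a ≠ 0 := by
  rintro rfl
  rw [centralBinomial, ZeroMemClass.coe_zero, map_zero, sub_zero] at haf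
  exact t_pow_notMem_span (coeff_zero_ne_zero_of_isRightCoprime hft) hf _ haf

theorem coeff_aeval_t_pow {n : ℕ} (hn : 0 < n) (p : Polynomial (fixedField σ)) (k : ℕ) :
    coeff (Polynomial.aeval (t σ ^ n) p) k = if n ∣ k then (p.coeff (k / n) : K) else 0 := by
  have hterm (i : ℕ) : coeff (p.coeff i • (t σ ^ n) ^ i) k =
      if k = n * i then (p.coeff i : K) else 0 := by
    rw [← pow_mul]
    exact coeff_const_mul_t_pow _ _ _
  simp only [Polynomial.aeval_eq_sum_range, map_sum, Finset.sum_apply, hterm]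
  split_ifs with hk
  · obtain ⟨j, rfl⟩ := hk
    simp only [Nat.mul_div_cancel_left j hn, Nat.mul_right_inj hn.ne', sum_ite_eq]
    split_ifs with hj
    · rfl
    · rw [Polynomial.coeff_eq_zero_of_natDegree_lt (by simpa using hj), ZeroMemClass.coe_zero]
  · exact sum_eq_zero fun i _ => if_neg fun h => hk ⟨i, h⟩

theorem aeval_t_pow_injective {n : ℕ} (hn : 0 < n) :
    Function.Injective (Polynomial.aeval (R := fixedField σ) (t σ ^ n)) := fun p q h =>
  Polynomial.ext fun i => Subtype.ext <| by
    simpa [coeff_aeval_t_pow hn, hn] using congr_fun (congr_arg coeff h) (n * i)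

theorem natDegree_aeval_t_pow {n : ℕ} (hn : 0 < n) (p : Polynomial (fixedField σ)) :
    natDegree (Polynomial.aeval (t σ ^ n) p) = n * p.natDegree := by
  rcases eq_or_ne p 0 with rfl | hp
  · rw [map_zero, Polynomial.natDegree_zero, mul_zero]
    rfl
  refine natDegree_eq ?_ fun k hk => ?_
  · rw [coeff_aeval_t_pow hn, if_pos (dvd_mul_right _ _), Nat.mul_div_cancel_left _ hn]
    exact fun h => hp (Polynomial.leadingCoeff_eq_zero.1 (Subtype.ext h))
  · rw [coeff_aeval_t_pow hn]
    refine ite_eq_right_iff.2 ?_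
    rintro ⟨j, rfl⟩
    rw [Nat.mul_div_cancel_left _ hn, Polynomial.coeff_eq_zero_of_natDegree_lt
      (Nat.lt_of_mul_lt_mul_left hk), ZeroMemClass.coe_zero]

theorem aeval_t_pow_orderOf_mem_center (p : Polynomial (fixedField σ)) :
    Polynomial.aeval (t σ ^ orderOf σ) p ∈ Subring.center (SkewPoly σ) := by
  have ht : t σ ^ orderOf σ ∈ Subalgebra.center (fixedField σ) (SkewPoly σ) :=
    Subalgebra.mem_center_iff.2 fun q => (commute_t_pow_orderOf q).eq.symm
  exact Algebra.adjoin_le (Set.singleton_subset_iff.2 ht)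
    (Polynomial.aeval_mem_adjoin_singleton (fixedField σ) _)

theorem aeval_t_pow_X_sub_C (a : fixedField σ) :
    Polynomial.aeval (t σ ^ orderOf σ) (Polynomial.X - Polynomial.C a) = centralBinomial a := by
  rw [map_sub, Polynomial.aeval_X, Polynomial.aeval_C]
  rfl

theorem IsMinimalCentralLeftMultiple.dvd (hσ : IsOfFinOrder σ) {f : SkewPoly σ}
    {hhat : Polynomial (fixedField σ)} (hmin : IsMinimalCentralLeftMultiple (orderOf σ) f hhat)
    {p : Polynomial (fixedField σ)}
    (hp : Polynomial.aeval (t σ ^ orderOf σ) p ∈ Ideal.span {f}) : hhat ∣ p := by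
  rw [← Polynomial.modByMonic_eq_zero_iff_dvd hmin.monic]
  by_contra hr
  have hmem : Polynomial.aeval (t σ ^ orderOf σ) (p %ₘ hhat) ∈ Ideal.span {f} := by
    rw [Polynomial.modByMonic_eq_sub_mul_div, mul_comm, map_sub, map_mul]
    exact sub_mem hp (Ideal.mul_mem_left _ _ hmin.left_multiple)
  have haeval : Polynomial.aeval (t σ ^ orderOf σ) (p %ₘ hhat) ≠ 0 :=
    (map_ne_zero_iff _ (aeval_t_pow_injective hσ.orderOf_pos)).2 hr
  have hle := hmin.minimal _ (aeval_t_pow_orderOf_mem_center _) haeval hmem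
  rw [natDegree_aeval_t_pow hσ.orderOf_pos, natDegree_aeval_t_pow hσ.orderOf_pos] at hle
  exact (Polynomial.natDegree_lt_natDegree hr (Polynomial.degree_modByMonic_lt p hmin.monic)).not_ge
    (Nat.le_of_mul_le_mul_left hle hσ.orderOf_pos)

theorem pow_length_mem_span_prod {R : Type*} [Ring R] {z : R} (hz : ∀ x, Commute z x) {L : List R}
    (hL : ∀ l ∈ L, z ∈ Ideal.span {l}) : z ^ L.length ∈ Ideal.span {L.prod} := by
  induction L with
  | nil => simp
  | cons l L ih =>
    obtain ⟨q, hq⟩ := Ideal.mem_span_singleton'.1 (ih fun x hx => hL x (List.mem_cons_of_mem l hx))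
    obtain ⟨q', hq'⟩ := Ideal.mem_span_singleton'.1 (hL l List.mem_cons_self)
    refine Ideal.mem_span_singleton'.2 ⟨q * q', ?_⟩
    rw [List.prod_cons, mul_assoc, ← mul_assoc q', hq', ← mul_assoc, ← (hz q).eq, mul_assoc, hq,
      List.length_cons, pow_succ']

theorem centralBinomial_norm_mem_span_of_eq_prod (hσ : IsOfFinOrder σ) {m : ℕ} (hm : m ≠ 0)
    (c : Fin m → Kˣ) (b : K) {f : SkewPoly σ}
    (hf : f = (List.ofFn fun i : Fin m => t σ - const σ (Omega σ (c i) b)).prod)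
    {hhat : Polynomial (fixedField σ)} (hmin : IsMinimalCentralLeftMultiple (orderOf σ) f hhat)
    (hsq : Squarefree hhat) :
    centralBinomial (Algebra.norm (fixedField σ) b) ∈ Ideal.span {f} := by
  have hpow := pow_length_mem_span_prod
    (commute_centralBinomial (Algebra.norm (fixedField σ) b))
    (L := List.ofFn fun i : Fin m => t σ - const σ (Omega σ (c i) b)) fun l hl => by
      obtain ⟨i, rfl⟩ := (List.mem_ofFn' _ _).1 hl
      rw [← norm_Omega hσ (c i)]
      exact centralBinomial_norm_mem_span hσ _
  rw [← hf, List.length_ofFn, ← aeval_t_pow_X_sub_C, ← map_pow] at hpow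
  obtain ⟨q, hq⟩ := (hsq.dvd_pow_iff_dvd hm).1 (hmin.dvd hσ hpow)
  rw [← aeval_t_pow_X_sub_C, hq, mul_comm, map_mul]
  exact Ideal.mul_mem_left _ _ hmin.left_multiple

end CentralMultiple

end SkewPoly

end

theorem corollary6 {K : Type*} [Field K] (σ : K ≃+* K) (n : ℕ) (hn : n.Prime)
    (hσ : orderOf σ = n) (f : SkewPoly σ) (m : ℕ) (hm : SkewPoly.natDegree f = m) (hm1 : 1 ≤ m)
    (hmonic : SkewPoly.IsMonic f) (hft : SkewPoly.IsRightCoprime f (SkewPoly.t σ))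
    (hhat : Polynomial (SkewPoly.fixedField σ))
    (hmin : SkewPoly.IsMinimalCentralLeftMultiple n f hhat) (hsq : Squarefree hhat) :
    (IsGeneralisedAPolynomial f ↔
      (∃ a : SkewPoly.fixedField σ, a ≠ 0 ∧
        (∀ b : K, a ≠ Algebra.norm (SkewPoly.fixedField σ) b) ∧
        f = SkewPoly.t σ ^ n - SkewPoly.const σ (a : K)) ∨
      (m ≤ n ∧ ∃ (c : Fin m → Kˣ) (b : Kˣ),
        (∀ i : Fin m, (i : ℕ) + 1 = m → c i = 1) ∧
        f = (List.ofFn fun i : Fin m =>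
          SkewPoly.t σ - SkewPoly.const σ (SkewPoly.Omega σ (c i) (b : K))).prod)) ∧
    (∀ a : SkewPoly.fixedField σ, a ≠ 0 →
      (∀ b : K, a ≠ Algebra.norm (SkewPoly.fixedField σ) b) →
      f = SkewPoly.t σ ^ n - SkewPoly.const σ (a : K) → Irreducible f) := by
  subst hσ hm
  have hσ : IsOfFinOrder σ := orderOf_pos_iff.1 hn.pos
  have := SkewPoly.finite_fixedField hσ
  refine ⟨⟨fun hf => ?_, ?_⟩, ?_⟩
  · obtain ⟨a, haf⟩ := SkewPoly.exists_centralBinomial_mem hf.central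
    have ha := SkewPoly.ne_zero_of_centralBinomial_mem_span hft hm1 haf
    by_cases hnorm : ∃ b : K, a = Algebra.norm (SkewPoly.fixedField σ) b
    · obtain ⟨b, rfl⟩ := hnorm
      exact .inr ⟨SkewPoly.natDegree_le_orderOf hσ haf,
        SkewPoly.exists_eq_normalised_prod_linear hσ (Algebra.norm_ne_zero_iff.1 ha) hmonic hm1 haf⟩
    · push Not at hnorm
      exact .inl ⟨a, ha, hnorm, SkewPoly.eq_centralBinomial hn ha hnorm hmonic hm1 haf⟩
  · rintro (⟨a, ha, -, rfl⟩ | ⟨-, c, b, -, hprod⟩)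
    · exact SkewPoly.isGeneralisedAPolynomial_of_centralBinomial_mem hσ hm1 ha
        (Ideal.mem_span_singleton_self _)
    · exact SkewPoly.isGeneralisedAPolynomial_of_centralBinomial_mem hσ hm1
        (Algebra.norm_ne_zero_iff.2 b.ne_zero) <|
        SkewPoly.centralBinomial_norm_mem_span_of_eq_prod hσ (Nat.ne_of_gt hm1) c b hprod hmin hsq
  · rintro a ha hnorm rfl
    exact SkewPoly.irreducible_centralBinomial hn ha hnorm
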